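/- Let $L\ge 3$, $0<\lambda<1$ and $\gamma_p,\theta_p,\theta_s,\sigma^2>0$. Let $g_p\sim\exp(1)$, let $h_x\in\mathbb C^L$ have i.i.d. $\mathcal{CN}(0,\lambda)$ entries and $h_s\in\mathbb C^L$ i.i.d. $\mathcal{CN}(0,1)$ entries, and put $g_x=\|h_x\|^2/\lambda$, $s_x=h_x/\|h_x\|$, $g_s=\|h_s\|^2$, $s_s=h_s/\|h_s\|$. Let the unit vector $\hat s_x=Q(s_x,U)$ be the output of a $B$-bit (possibly randomized) quantizer of $s_x$, where $g_p,h_x,h_s,U$ are independent and the quantization error $\epsilon=1-|\hat s_x^\dagger s_x|^2$ satisfies $\Pr(\epsilon\le\tau)=2^B\tau^{L-1}$ for $0\le\tau\le 2^{-B/(L-1)}$ and $\Pr(\epsilon\le\tau)=1$ for larger $\tau$. Let $\omega=\sigma^2(\gamma_pg_p/\theta_p-1)$, and let the secondary-user (SU) power budget be $P_s=\min\{\omega/(\lambda g_x\epsilon),P_{\max}\}$ if $\omega\ge0$ and $P_s=P_{\max}$ if $\omega<0$ (perfect interference-power-control feedback, no feedforward). The orthogonal cognitive beamformer $f$ maximizes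 $|f^\dagger s_s|^2$ subject to $f^\dagger\hat s_x=0$ and $\|f\|^2\le P_s$, and the SU outage probability is $$P_{\rm out}=\Pr\Bigl(\tfrac{g_s}{\sigma^2}|f^\dagger s_s|^2\le\theta_s\Bigr).$$ Then for every integer $B\ge0$ the limit $P_\infty(B)=\lim_{P_{\max}\to\infty}P_{\rm out}$ exists and depends only on $L,\lambda,\gamma_p,\theta_p,\theta_s,B$. As $B\to\infty$ with the other parameters fixed, if $L\ge4$, $$P_\infty(B)=e^{-\theta_p/\gamma_p}\,\frac{(L-1)\lambda\theta_p\theta_s}{(L-2)\gamma_p}\,2^{-\frac{B}{L-1}}+O\bigl(2^{-\frac{2B}{L-1}}\bigr),$$ and if $L=3$ the same expansion holds with the error term $O\bigl(B\,2^{-\frac{2B}{L-1}}\bigr)$. Moreover, for every $L\ge3$ there is a function $R(B)=O\bigl(2^{-\frac{2B}{L-1}}\bigr)$ with $$P_\infty(B)>e^{-\theta_p/\gamma_p}\,\frac{\lambda\theta_p\theta_s}{\gamma_p}\,2^{-\frac{B}{L-1}}+R(B)\quad\text{for all }B\ge0,$$ and for all sufficiently large $B$ this inequality holds with $R(B)=0$.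 -/

import Mathlib

open MeasureTheory ProbabilityTheory Filter Topology Asymptotics

namespace CognitiveBeamforming

/-- The law `CN(0, v)` of a circularly symmetric complex Gaussian variable with mean zero and
variance `v`: real and imaginary parts are independent real Gaussians of variance `v / 2`. -/
noncomputable def complexGaussian (v : ℝ) : Measure ℂ :=
  ((gaussianReal 0 (v / 2).toNNReal).prod (gaussianReal 0 (v / 2).toNNReal)).map
    (fun p : ℝ × ℝ => (⟨p.1, p.2⟩ : ℂ))

/-- The law of an `L × 1` vector with i.i.d. `CN(0, v)` entries. -/
noncomputable def complexGaussianVec (L : ℕ) (v : ℝ) : Measure (EuclideanSpace ℂ (Fin L)) :=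
  (Measure.pi (fun _ : Fin L => complexGaussian v)).map (WithLp.toLp 2)

/-- The channel shape `h / ‖h‖` of a channel vector `h`. -/
noncomputable def shape {L : ℕ} (h : EuclideanSpace ℂ (Fin L)) : EuclideanSpace ℂ (Fin L) :=
  ((‖h‖⁻¹ : ℝ) : ℂ) • h

/-- The quantization error `ε = 1 - |ŝ† s|²`; `inner ℂ a b` is `a† b`. -/
noncomputable def quantError {L : ℕ} (sHat s : EuclideanSpace ℂ (Fin L)) : ℝ :=
  1 - ‖inner ℂ sHat s‖ ^ 2

/-- The random variables of the system on a probability space `(Ω, μ)`: primary channel power `gp`,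
interference channel `hx` (SU transmitter to PU receiver), secondary channel `hs`, and the
quantizer of the shape of `hx` with `B` feedback bits. The quantizer `Q` may use additional
randomness `U`, so that the quantized shape is `Q (shape hx) U`; `gp`, `hx`, `hs`, `U` are
mutually independent. -/
structure SystemModel {Ω 𝒰 : Type*} [MeasurableSpace Ω] [MeasurableSpace 𝒰]
    (μ : Measure Ω) (L : ℕ) (lam : ℝ) (B : ℕ) where
  gp : Ω → ℝ
  hx : Ω → EuclideanSpace ℂ (Fin L)
  hs : Ω → EuclideanSpace ℂ (Fin L)
  U : Ω → 𝒰
  Q : EuclideanSpace ℂ (Fin L) → 𝒰 → EuclideanSpace ℂ (Fin L)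
  measurable_gp : Measurable gp
  measurable_hx : Measurable hx
  measurable_hs : Measurable hs
  measurable_U : Measurable U
  measurable_Q : Measurable (Function.uncurry Q)
  law_gp : μ.map gp = expMeasure 1
  law_hx : μ.map hx = complexGaussianVec L lam
  law_hs : μ.map hs = complexGaussianVec L 1
  indep_gp : IndepFun gp (fun ω => (hx ω, hs ω, U ω)) μ
  indep_hx : IndepFun hx (fun ω => (hs ω, U ω)) μ
  indep_hs : IndepFun hs U μ
  norm_Q : ∀ s u, ‖s‖ = 1 → ‖Q s u‖ = 1
  /-- The cumulative distribution function of the quantization error. -/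
  quantError_cdf : ∀ τ : ℝ, 0 ≤ τ → τ ≤ (2 : ℝ) ^ (-(B : ℝ) / ((L : ℝ) - 1)) →
    μ.real {ω | quantError (Q (shape (hx ω)) (U ω)) (shape (hx ω)) ≤ τ} = 2 ^ B * τ ^ (L - 1)
  quantError_cdf_one : ∀ τ : ℝ, (2 : ℝ) ^ (-(B : ℝ) / ((L : ℝ) - 1)) ≤ τ →
    μ.real {ω | quantError (Q (shape (hx ω)) (U ω)) (shape (hx ω)) ≤ τ} = 1

/-- The interference margin `σ² (γ_p g_p / θ_p - 1)` at the PU receiver. -/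
noncomputable def interferenceMargin (σ2 γp θp gp : ℝ) : ℝ := σ2 * (γp * gp / θp - 1)

/-- The unquantized interference-power-control signal `η` without feedforward, as a function of
the margin `w`, the interference channel gain `gx` and the quantization error `ε`. -/
noncomputable def ipcSignal (lam Pmax w gx ε : ℝ) : ℝ :=
  if 0 ≤ w then w / (lam * gx * ε) else Pmax

/-- The SU power budget when the signal `η` is fed back perfectly. -/
noncomputable def powerBudget (lam Pmax w gx ε : ℝ) : ℝ :=
  if 0 ≤ w ∧ ipcSignal lam Pmax w gx ε < Pmax then ipcSignal lam Pmax w gx ε else Pmax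

/-- `f` is an orthogonal cognitive beamformer: it maximizes `|f† s|²` subject to `f† ŝ = 0` and
`‖f‖² ≤ P`. -/
def IsOCB {L : ℕ} (sHat s : EuclideanSpace ℂ (Fin L)) (P : ℝ)
    (f : EuclideanSpace ℂ (Fin L)) : Prop :=
  f ∈ {v : EuclideanSpace ℂ (Fin L) | inner ℂ v sHat = 0 ∧ ‖v‖ ^ 2 ≤ P} ∧
  IsMaxOn (fun v : EuclideanSpace ℂ (Fin L) => ‖inner ℂ v s‖ ^ 2)
    {v : EuclideanSpace ℂ (Fin L) | inner ℂ v sHat = 0 ∧ ‖v‖ ^ 2 ≤ P} f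

namespace SystemModel

variable {Ω 𝒰 : Type*} [MeasurableSpace Ω] [MeasurableSpace 𝒰]
  {μ : Measure Ω} {L : ℕ} {lam : ℝ} {B : ℕ}

/-- The quantized interference channel shape `ŝ_x`. -/
noncomputable def sxHat (M : SystemModel (𝒰 := 𝒰) μ L lam B) (ω : Ω) : EuclideanSpace ℂ (Fin L) :=
  M.Q (shape (M.hx ω)) (M.U ω)

/-- The interference channel gain `g_x = ‖h_x‖² / λ`. -/
noncomputable def gx (M : SystemModel (𝒰 := 𝒰) μ L lam B) (ω : Ω) : ℝ := ‖M.hx ω‖ ^ 2 / lam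

/-- The SU power budget: quantized CDI, perfect IPC feedback, no feedforward. -/
noncomputable def suPower (M : SystemModel (𝒰 := 𝒰) μ L lam B) (σ2 γp θp Pmax : ℝ) (ω : Ω) : ℝ :=
  powerBudget lam Pmax (interferenceMargin σ2 γp θp (M.gp ω)) (M.gx ω)
    (quantError (M.sxHat ω) (shape (M.hx ω)))

/-- For the maximal power `Pmax`, the random beamformer `f` is almost surely an orthogonal
cognitive beamformer under the above power budget. -/
def IsBeamformer (M : SystemModel (𝒰 := 𝒰) μ L lam B) (σ2 γp θp Pmax : ℝ)
    (f : Ω → EuclideanSpace ℂ (Fin L)) : Prop :=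
  ∀ᵐ ω ∂μ, IsOCB (M.sxHat ω) (shape (M.hs ω)) (M.suPower σ2 γp θp Pmax ω) (f ω)

/-- The receive SNR `(g_s / σ²) |f† s_s|²` at the SU receiver, with `g_s = ‖h_s‖²`. -/
noncomputable def snr (M : SystemModel (𝒰 := 𝒰) μ L lam B) (σ2 : ℝ)
    (f : Ω → EuclideanSpace ℂ (Fin L)) (ω : Ω) : ℝ :=
  ‖M.hs ω‖ ^ 2 / σ2 * ‖inner ℂ (f ω) (shape (M.hs ω))‖ ^ 2

/-- The SU outage probability `Pr(SNR_s ≤ θ_s)`. -/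
noncomputable def outage (M : SystemModel (𝒰 := 𝒰) μ L lam B) (σ2 θs : ℝ)
    (f : Ω → EuclideanSpace ℂ (Fin L)) : ℝ :=
  μ.real {ω | M.snr σ2 f ω ≤ θs}

end SystemModel

end CognitiveBeamforming

namespace CognitiveBeamforming

-- Write `n = L - 1`, `a = θp / γp`, `δ = 2 ^ (-B / n)`, and let `G = ‖h_s‖² - |ŝ_x† h_s|²` be the
-- secondary power left after projecting away the quantized direction. The optimal beamformer
-- achieves SNR `G P_s / σ²`. As the power cap grows, a negative margin eventually gives no outage,
-- while for a nonnegative margin the cap becomes inactive and outage means `G (g_p / a - 1) ≤ λ θs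
-- · g_x ε`. Almost everywhere convergence of indicators turns this into convergence of
-- probabilities (`SystemModel.tendsto_outage`).
--
-- The limit event involves three independent variables. The gain `g_p` is exponential. The leakage
-- `g_x ε` is `δ W`, with `W` a Gamma(`n + 1`) variable times an independent `u ^ (1 / n)`, because
-- the norm of a Gaussian vector is independent of its shape. Finally `G` is Gamma(`n`): for any
-- fixed unit codeword, the projection of `h_s` onto its orthogonal complement is again Gaussian, so
-- the law does not depend on the codeword (`SystemModel.measurePreserving_gp_leakage_orthGain`).
-- Integrating out `g_p` gives `P_∞ = e^{-a} E[1 - exp(-c δ W / G)]` with `c = a λ θs`, which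
-- depends only on the allowed parameters.
--
-- Since `E W = n` and `E G⁻¹ = 1 / (n - 1)`, the linear term is `c δ n / (n - 1)`. The remainder is
-- at most `E min(y, y²)` with `y = c δ W / G`. This is `O(δ²)` when `E G⁻²` is finite, that is for
-- `n ≥ 3`; for `n = 2` truncating at `G = c δ` costs a factor `log (1 / δ)`, of order `B`. The
-- floor follows from `n / (n - 1) > 1`.

-- Complex Gaussian vectors: characteristic function and density.

theorem real_inner_eq_re {n : ℕ} (x y : EuclideanSpace ℂ (Fin n)) :
    inner ℝ x y = (inner ℂ x y).re := by
  simp [PiLp.inner_apply]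

theorem finrank_real_euclideanSpace_complex (n : ℕ) :
    Module.finrank ℝ (EuclideanSpace ℂ (Fin n)) = 2 * n := by
  rw [← Module.finrank_mul_finrank ℝ ℂ, Complex.finrank_real_complex]; simp

theorem nontrivial_euclideanSpace_complex {n : ℕ} (hn : 0 < n) :
    Nontrivial (EuclideanSpace ℂ (Fin n)) := by
  refine Module.nontrivial_of_finrank_pos (R := ℝ) ?_
  rw [finrank_real_euclideanSpace_complex]
  positivity

theorem measurable_complex_mk : Measurable (fun p : ℝ × ℝ => (⟨p.1, p.2⟩ : ℂ)) :=
  Complex.measurableEquivRealProd.symm.measurable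

instance (v : ℝ) : IsProbabilityMeasure (complexGaussian v) :=
  Measure.isProbabilityMeasure_map measurable_complex_mk.aemeasurable

instance (L : ℕ) (v : ℝ) : IsProbabilityMeasure (complexGaussianVec L v) :=
  Measure.isProbabilityMeasure_map (by fun_prop)

instance (L : ℕ) (v : ℝ) : SFinite (complexGaussianVec L v) :=
  @instSFiniteOfSigmaFinite _ _ _ (IsFiniteMeasure.toSigmaFinite _)

theorem charFun_complexGaussian {v : ℝ} (hv : 0 ≤ v) (t : ℂ) :
    charFun (complexGaussian v) t = Complex.exp (-(v * ‖t‖ ^ 2 / 4 : ℝ)) := by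
  rw [charFun_apply, complexGaussian, integral_map measurable_complex_mk.aemeasurable
    (by fun_prop)]
  have h : ∀ p : ℝ × ℝ, Complex.exp ((inner ℝ (⟨p.1, p.2⟩ : ℂ) t : ℝ) * Complex.I)
      = Complex.exp ((t.re : ℂ) * p.1 * Complex.I) * Complex.exp ((t.im : ℂ) * p.2 * Complex.I) := by
    intro p
    rw [← Complex.exp_add, Complex.inner]
    congr 1
    simp
    ring
  simp_rw [h]
  rw [integral_prod_mul (fun x : ℝ => Complex.exp ((t.re : ℂ) * x * Complex.I))
    (fun x : ℝ => Complex.exp ((t.im : ℂ) * x * Complex.I)), ← charFun_apply_real,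
    ← charFun_apply_real, charFun_gaussianReal, charFun_gaussianReal, ← Complex.exp_add]
  congr 1
  have h2 : (((v / 2).toNNReal : ℝ) : ℂ) = v / 2 := by
    rw [Real.coe_toNNReal _ (by positivity)]; simp
  rw [h2]
  have h3 : ‖t‖ ^ 2 = t.re ^ 2 + t.im ^ 2 := by
    rw [← Complex.normSq_eq_norm_sq, Complex.normSq_apply]; ring
  rw [h3]
  push_cast
  ring

/-- Dependence on `‖t‖` alone is what makes these laws stable under unitary changes of basis and
orthogonal projections. -/
theorem charFun_complexGaussianVec (n : ℕ) {v : ℝ} (hv : 0 ≤ v) (t : EuclideanSpace ℂ (Fin n)) :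
    charFun (complexGaussianVec n v) t = Complex.exp (-(v * ‖t‖ ^ 2 / 4 : ℝ)) := by
  rw [complexGaussianVec, charFun_pi]
  simp_rw [charFun_complexGaussian hv]
  rw [← Complex.exp_sum, EuclideanSpace.norm_sq_eq]
  congr 1
  push_cast
  rw [Finset.sum_neg_distrib, Finset.mul_sum, Finset.sum_div]

/-- The density of `CN(0, v)` vectors. -/
noncomputable def gaussianDensity (n : ℕ) (v r : ℝ) : ℝ :=
  ((Real.pi * v) ^ n)⁻¹ * Real.exp (-(v⁻¹) * r ^ 2)

theorem gaussianDensity_nonneg (n : ℕ) {v : ℝ} (hv : 0 ≤ v) (r : ℝ) :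
    0 ≤ gaussianDensity n v r := by unfold gaussianDensity; positivity

theorem measurable_gaussianDensity (n : ℕ) (v : ℝ) : Measurable (gaussianDensity n v) := by
  unfold gaussianDensity; fun_prop

theorem integral_gaussianDensity_smul (n : ℕ) {v : ℝ} (hv : 0 < v)
    (f : EuclideanSpace ℂ (Fin n) → ℂ) :
    ∫ z, f z ∂(volume.withDensity fun z => ENNReal.ofReal (gaussianDensity n v ‖z‖)) =
      (((Real.pi * v) ^ n)⁻¹ : ℝ) * ∫ z, Complex.exp (-(v⁻¹ : ℝ) * ‖z‖ ^ 2) * f z := by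
  have hm : Measurable fun z : EuclideanSpace ℂ (Fin n) =>
      ENNReal.ofReal (gaussianDensity n v ‖z‖) :=
    ((measurable_gaussianDensity n v).comp measurable_norm).ennreal_ofReal
  rw [integral_withDensity_eq_integral_toReal_smul hm (by simp), ← integral_const_mul]
  congr with z
  rw [ENNReal.toReal_ofReal (gaussianDensity_nonneg n hv.le _), gaussianDensity,
    Complex.real_smul]
  push_cast
  ring

theorem pi_div_cpow_finrank (n : ℕ) {b : ℂ} :
    ((Real.pi : ℂ) / b) ^ ((Module.finrank ℝ (EuclideanSpace ℂ (Fin n)) : ℂ) / 2)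
      = (Real.pi / b) ^ n := by
  rw [finrank_real_euclideanSpace_complex, ← Complex.cpow_natCast]
  congr 1
  push_cast
  ring

theorem isProbabilityMeasure_gaussianDensity (n : ℕ) {v : ℝ} (hv : 0 < v) :
    IsProbabilityMeasure ((volume : Measure (EuclideanSpace ℂ (Fin n))).withDensity
      fun z => ENNReal.ofReal (gaussianDensity n v ‖z‖)) := by
  constructor
  have hint : ∫ z : EuclideanSpace ℂ (Fin n), gaussianDensity n v ‖z‖ = 1 := by
    unfold gaussianDensity
    rw [integral_const_mul, GaussianFourier.integral_rexp_neg_mul_sq_norm (by positivity),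
      finrank_real_euclideanSpace_complex]
    have : ((2 * n : ℕ) : ℝ) / 2 = n := by push_cast; ring
    rw [this, Real.rpow_natCast, div_inv_eq_mul]
    exact inv_mul_cancel₀ (by positivity)
  rw [withDensity_apply _ MeasurableSet.univ, Measure.restrict_univ,
    ← ofReal_integral_eq_lintegral_ofReal, hint, ENNReal.ofReal_one]
  -- Integrability comes for free: a non-integrable function would have Bochner integral `0`, not
  -- `1`.
  · by_contra h
    rw [integral_undef h] at hint
    norm_num at hint
  · exact ae_of_all _ fun z => gaussianDensity_nonneg n hv.le _

/-- Both sides have the same characteristic function. The radial form of the density gives access to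
polar coordinates. -/
theorem complexGaussianVec_eq_withDensity (n : ℕ) {v : ℝ} (hv : 0 < v) :
    complexGaussianVec n v =
      volume.withDensity fun z => ENNReal.ofReal (gaussianDensity n v ‖z‖) := by
  have := isProbabilityMeasure_gaussianDensity n hv
  refine Measure.ext_of_charFun (funext fun t => ?_)
  rw [charFun_complexGaussianVec n hv.le, charFun_apply, integral_gaussianDensity_smul n hv]
  have h : ∀ z : EuclideanSpace ℂ (Fin n),
      Complex.exp (-(v⁻¹ : ℝ) * ‖z‖ ^ 2) * Complex.exp ((inner ℝ z t : ℝ) * Complex.I)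
      = Complex.exp (-(v⁻¹ : ℝ) * ‖z‖ ^ 2 + Complex.I * (inner ℝ t z : ℝ)) := by
    intro z
    rw [← Complex.exp_add, real_inner_comm, mul_comm Complex.I]
  simp_rw [h]
  have hv' : (v : ℂ) ≠ 0 := by exact_mod_cast hv.ne'
  rw [GaussianFourier.integral_cexp_neg_mul_sq_norm_add (by simpa using hv), pi_div_cpow_finrank]
  push_cast
  rw [div_inv_eq_mul, ← mul_assoc, inv_mul_cancel₀ (by
    have : (Real.pi : ℂ) ≠ 0 := by exact_mod_cast Real.pi_ne_zero
    positivity), one_mul]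
  congr 1
  rw [Complex.I_sq]
  field_simp

-- Gamma laws of squared norms and of orthogonal projections.

theorem integral_gammaMeasure {a : ℝ} (ha : 0 < a) {E : Type*} [NormedAddCommGroup E]
    [NormedSpace ℝ E] (f : ℝ → E) :
    ∫ x, f x ∂(gammaMeasure a 1) =
      (Real.Gamma a)⁻¹ • ∫ x in Set.Ioi 0, (x ^ (a - 1) * Real.exp (-x)) • f x := by
  have hm : Measurable (gammaPDF a 1) := (measurable_gammaPDFReal a 1).ennreal_ofReal
  rw [gammaMeasure, integral_withDensity_eq_integral_toReal_smul hm (by simp [gammaPDF])]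
  have h : ∀ x : ℝ, (gammaPDF a 1 x).toReal • f x =
      (Set.Ici 0).indicator (fun x : ℝ => (Real.Gamma a)⁻¹ •
        ((x ^ (a - 1) * Real.exp (-x)) • f x)) x := by
    intro x
    rw [gammaPDF, ENNReal.toReal_ofReal (gammaPDFReal_nonneg ha one_pos x), gammaPDFReal]
    by_cases hx : 0 ≤ x
    · rw [if_pos hx, Set.indicator_of_mem (show x ∈ Set.Ici 0 from hx), smul_smul, Real.one_rpow]
      congr 1
      rw [one_mul]
      ring
    · rw [if_neg hx, Set.indicator_of_notMem (show x ∉ Set.Ici 0 from hx), zero_smul]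
  simp_rw [h]
  rw [integral_indicator measurableSet_Ici, integral_Ici_eq_integral_Ioi, integral_smul]

/-- The substitution `x = y² / v` turns the radial integral in real dimension `2 n` into a
Gamma(`n`) integral. -/
theorem integral_Ioi_pow_sq {n : ℕ} (hn : 0 < n) {v : ℝ} (hv : 0 < v) (f : ℝ → ℂ) :
    ∫ y in Set.Ioi (0 : ℝ), y ^ (2 * n - 1) • (Complex.exp (-(v⁻¹ : ℝ) * y ^ 2) * f (y ^ 2 / v))
      = ((v ^ n / 2 : ℝ) : ℂ) * ∫ x in Set.Ioi (0 : ℝ), (x ^ ((n : ℝ) - 1) * Real.exp (-x)) • f x := by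
  have h1 := integral_comp_rpow_Ioi_of_pos
    (g := fun y : ℝ => ((y ^ (n - 1) * Real.exp (-(y / v))) • f (y / v))) (p := 2) two_pos
  have h2 := integral_comp_mul_right_Ioi
    (fun x : ℝ => ((v * x) ^ (n - 1) * Real.exp (-x)) • f x) 0 (b := v⁻¹) (by positivity)
  have h3 : ∀ y ∈ Set.Ioi (0 : ℝ),
      y ^ (2 * n - 1) • (Complex.exp (-(v⁻¹ : ℝ) * y ^ 2) * f (y ^ 2 / v)) =
      (1 / 2 : ℝ) • (((2 : ℝ) * y ^ ((2 : ℝ) - 1)) •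
        (((y ^ (2 : ℝ)) ^ (n - 1) * Real.exp (-(y ^ (2 : ℝ) / v))) • f (y ^ (2 : ℝ) / v))) := by
    intro y _
    have e1 : y ^ (2 * n - 1) = y * (y ^ 2) ^ (n - 1) := by
      rw [← pow_mul, ← pow_succ']
      congr 1
      omega
    have e2 : y ^ ((2 : ℝ) - 1) = y := by norm_num
    rw [e1, e2, Real.rpow_two]
    simp only [Complex.real_smul]
    push_cast
    have e3 : -(v : ℂ)⁻¹ * (y : ℂ) ^ 2 = -((y : ℂ) ^ 2 / v) := by ring
    rw [e3]
    ring
  rw [setIntegral_congr_fun measurableSet_Ioi h3, integral_smul, h1]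
  have h4 : ∀ x : ℝ, ((v * (x * v⁻¹)) ^ (n - 1) * Real.exp (-(x * v⁻¹))) • f (x * v⁻¹)
      = (x ^ (n - 1) * Real.exp (-(x / v))) • f (x / v) := by
    intro x
    rw [← div_eq_mul_inv, mul_div_cancel₀ _ hv.ne']
  simp_rw [h4] at h2
  rw [h2]
  have h5 : ∀ x ∈ Set.Ioi (0 : ℝ), ((v * x) ^ (n - 1) * Real.exp (-x)) • f x =
      v ^ (n - 1) • ((x ^ ((n : ℝ) - 1) * Real.exp (-x)) • f x) := by
    intro x _
    have : x ^ ((n : ℝ) - 1) = x ^ (n - 1) := by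
      rw [← Real.rpow_natCast, Nat.cast_pred hn]
    rw [this, smul_smul, mul_pow]
    ring_nf
  rw [zero_mul, setIntegral_congr_fun measurableSet_Ioi h5, integral_smul, smul_smul, smul_smul,
    Complex.real_smul]
  congr 2
  obtain ⟨m, rfl⟩ : ∃ m, n = m + 1 := ⟨n - 1, by omega⟩
  simp only [Nat.add_sub_cancel, inv_inv]
  ring

/-- Polar coordinates give the Gamma integral up to a constant `K` independent of the test function,
and characteristic functions then identify the law. -/
theorem map_norm_sq_complexGaussianVec {n : ℕ} (hn : 0 < n) {v : ℝ} (hv : 0 < v) :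
    (complexGaussianVec n v).map (fun z => ‖z‖ ^ 2 / v) = gammaMeasure n 1 := by
  have hn' : (0 : ℝ) < n := by exact_mod_cast hn
  have := isProbabilityMeasure_gammaMeasure hn' one_pos
  have hm : Measurable fun z : EuclideanSpace ℂ (Fin n) => ‖z‖ ^ 2 / v := by fun_prop
  have := Measure.isProbabilityMeasure_map (μ := complexGaussianVec n v) hm.aemeasurable
  have := nontrivial_euclideanSpace_complex hn
  obtain ⟨K, hK⟩ : ∃ K : ℂ, ∀ f : ℝ → ℂ, ∫ z, f (‖z‖ ^ 2 / v) ∂(complexGaussianVec n v) =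
      K * ∫ x, f x ∂(gammaMeasure n 1) := by
    refine ⟨(((Real.pi * v) ^ n)⁻¹ : ℝ) * ((2 * n : ℕ) *
      ((volume : Measure (EuclideanSpace ℂ (Fin n))).real (Metric.ball 0 1) *
      ((v ^ n / 2 : ℝ) * Real.Gamma n))), fun f => ?_⟩
    have h := integral_fun_norm_addHaar (volume : Measure (EuclideanSpace ℂ (Fin n)))
      (fun y : ℝ => Complex.exp (-(v⁻¹ : ℝ) * y ^ 2) * f (y ^ 2 / v))
    rw [complexGaussianVec_eq_withDensity n hv, integral_gaussianDensity_smul n hv, h,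
      finrank_real_euclideanSpace_complex, integral_Ioi_pow_sq hn hv, integral_gammaMeasure hn',
      nsmul_eq_mul, Complex.real_smul, Complex.real_smul]
    have : (Real.Gamma n : ℂ) ≠ 0 := by exact_mod_cast (Real.Gamma_pos_of_pos hn').ne'
    push_cast
    field_simp
  -- Testing with the constant `1` normalizes `K`, so the volume of the ball is never computed.
  have hK1 : K = 1 := by simpa using (hK fun _ => 1).symm
  refine Measure.ext_of_charFun (funext fun t => ?_)
  rw [charFun_apply_real, charFun_apply_real, integral_map hm.aemeasurable (by fun_prop),
    hK (fun x => Complex.exp (t * x * Complex.I)), hK1, one_mul]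

/-- In orthonormal coordinates, the projection onto the complement of `s` is a standard Gaussian
vector in dimension `n`, whose squared norm is Gamma(`n`). -/
theorem map_orthogonal_complexGaussianVec {n : ℕ} (hn : 0 < n) {s : EuclideanSpace ℂ (Fin (n + 1))}
    (hs : ‖s‖ = 1) :
    (complexGaussianVec (n + 1) 1).map (fun h => ‖h‖ ^ 2 - ‖inner ℂ s h‖ ^ 2)
      = gammaMeasure n 1 := by
  have hs0 : s ≠ 0 := by rintro rfl; simp at hs
  have : Fact (Module.finrank ℂ (EuclideanSpace ℂ (Fin (n + 1))) = n + 1) := ⟨by simp⟩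
  let V : Submodule ℂ (EuclideanSpace ℂ (Fin (n + 1))) := (Submodule.span ℂ {s})ᗮ
  have hV : Module.finrank ℂ V = n := Submodule.finrank_orthogonal_span_singleton hs0
  let b : OrthonormalBasis (Fin n) ℂ V := (stdOrthonormalBasis ℂ V).reindex (finCongr hV)
  let T : EuclideanSpace ℂ (Fin (n + 1)) → EuclideanSpace ℂ (Fin n) :=
    fun h => b.repr (V.orthogonalProjectionOnto h)
  have hT : Measurable T := by
    refine Continuous.measurable ?_
    fun_prop
  have hTn : ∀ h, ‖T h‖ ^ 2 = ‖h‖ ^ 2 - ‖inner ℂ s h‖ ^ 2 := by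
    intro h
    have h1 : ‖h‖ ^ 2 = ‖(Submodule.span ℂ {s}).orthogonalProjectionOnto h‖ ^ 2
        + ‖V.orthogonalProjectionOnto h‖ ^ 2 :=
      Submodule.norm_sq_eq_add_norm_sq_projection h _
    have h2 : ‖(Submodule.span ℂ {s}).orthogonalProjectionOnto h‖ = ‖inner ℂ s h‖ := by
      change ‖(Submodule.span ℂ {s}).starProjection h‖ = _
      rw [Submodule.starProjection_unit_singleton ℂ hs, norm_smul, hs, mul_one]
    rw [h1, h2, LinearIsometryEquiv.norm_map]
    ring
  have hmap : (complexGaussianVec (n + 1) 1).map T = complexGaussianVec n 1 := by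
    have := Measure.isProbabilityMeasure_map (μ := complexGaussianVec (n + 1) 1) hT.aemeasurable
    refine Measure.ext_of_charFun (funext fun t => ?_)
    -- The adjoint of `T` is the isometric embedding of coordinates, so the characteristic function
    -- only sees `‖t‖`.
    have hin : ∀ h, inner ℝ (T h) t = inner ℝ h ((b.repr.symm t : V) : EuclideanSpace ℂ (Fin (n + 1))) := by
      intro h
      rw [real_inner_eq_re, real_inner_eq_re, LinearIsometryEquiv.inner_map_eq_flip,
        Submodule.inner_orthogonalProjectionOnto_eq_of_mem_right]
    rw [charFun_apply, integral_map hT.aemeasurable (by fun_prop)]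
    simp_rw [hin]
    have hnorm : ‖((b.repr.symm t : V) : EuclideanSpace ℂ (Fin (n + 1)))‖ = ‖t‖ :=
      b.repr.symm.norm_map t
    rw [← charFun_apply, charFun_complexGaussianVec _ zero_le_one,
      charFun_complexGaussianVec _ zero_le_one, hnorm]
  have hg := map_norm_sq_complexGaussianVec hn one_pos
  rw [← hmap, Measure.map_map (by fun_prop) hT] at hg
  rw [← hg]
  congr with h
  simp [hTn]

-- Independence of norm and shape.

open scoped ENNReal

theorem measurable_shape {n : ℕ} : Measurable (shape : EuclideanSpace ℂ (Fin n) → _) := by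
  unfold shape
  fun_prop

theorem norm_shape {n : ℕ} {h : EuclideanSpace ℂ (Fin n)} (hh : h ≠ 0) : ‖shape h‖ = 1 := by
  rw [shape, norm_smul, Complex.norm_real, norm_inv, norm_norm,
    inv_mul_cancel₀ (norm_ne_zero_iff.mpr hh)]

theorem norm_smul_shape {n : ℕ} {h : EuclideanSpace ℂ (Fin n)} (hh : h ≠ 0) :
    ((‖h‖ : ℝ) : ℂ) • shape h = h := by
  have : ((‖h‖ : ℝ) : ℂ) ≠ 0 := by exact_mod_cast norm_ne_zero_iff.mpr hh
  rw [shape, smul_smul, Complex.ofReal_inv, mul_inv_cancel₀ this, one_smul]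

theorem ae_ne_zero_complexGaussianVec {n : ℕ} (hn : 0 < n) {v : ℝ} (hv : 0 < v) :
    ∀ᵐ h ∂(complexGaussianVec n v), h ≠ 0 := by
  have := nontrivial_euclideanSpace_complex hn
  rw [complexGaussianVec_eq_withDensity n hv]
  refine (withDensity_absolutelyContinuous _ _).ae_le ?_
  exact compl_mem_ae_iff.mpr (measure_singleton 0)

theorem lintegral_norm_mul_shape (n : ℕ) {g : ℝ → ℝ≥0∞} (hg : Measurable g)
    {k : EuclideanSpace ℂ (Fin n) → ℝ≥0∞} (hk : Measurable k) (hn : 0 < n) :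
    ∫⁻ z : EuclideanSpace ℂ (Fin n), k (shape z) * g ‖z‖ =
      (∫⁻ s, k s.1 ∂(volume : Measure (EuclideanSpace ℂ (Fin n))).toSphere) *
        ∫⁻ r : Set.Ioi (0 : ℝ), g r.1 ∂(Measure.volumeIoiPow (2 * n - 1)) := by
  have := nontrivial_euclideanSpace_complex hn
  have hmp := (volume : Measure (EuclideanSpace ℂ (Fin n))).measurePreserving_homeomorphUnitSphereProd
  rw [finrank_real_euclideanSpace_complex] at hmp
  have h1 := hmp.lintegral_comp (f := fun p => k p.1.1 * g p.2.1)
    ((hk.comp (measurable_subtype_coe.comp measurable_fst)).mul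
      (hg.comp (measurable_subtype_coe.comp measurable_snd)))
  have h2 := lintegral_prod_mul
    (μ := (volume : Measure (EuclideanSpace ℂ (Fin n))).toSphere)
    (ν := Measure.volumeIoiPow (2 * n - 1)) (f := fun s => k s.1) (g := fun r => g r.1)
    (hk.comp measurable_subtype_coe).aemeasurable (hg.comp measurable_subtype_coe).aemeasurable
  have h3 : ∫⁻ z : EuclideanSpace ℂ (Fin n), k (shape z) * g ‖z‖ =
      ∫⁻ z in ({0}ᶜ : Set (EuclideanSpace ℂ (Fin n))), k (shape z) * g ‖z‖ := by
    rw [restrict_compl_singleton]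
  rw [h3, ← h2, ← h1, ← lintegral_subtype_comap (measurableSet_singleton _).compl]
  refine lintegral_congr fun z => ?_
  have h4 : shape z.1 = ‖z.1‖⁻¹ • z.1 := by
    ext i
    simp [shape]
  simp [h4]

/-- The density depends only on the norm, so in polar coordinates every rectangle has product
measure. -/
theorem indepFun_norm_shape {n : ℕ} (hn : 0 < n) {v : ℝ} (hv : 0 < v) :
    IndepFun (fun z : EuclideanSpace ℂ (Fin n) => ‖z‖) shape (complexGaussianVec n v) := by
  have key : ∀ (A : Set ℝ) (S : Set (EuclideanSpace ℂ (Fin n))), MeasurableSet A → MeasurableSet S →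
      complexGaussianVec n v ((fun z => ‖z‖) ⁻¹' A ∩ shape ⁻¹' S) =
      (∫⁻ s, S.indicator 1 s.1 ∂(volume : Measure (EuclideanSpace ℂ (Fin n))).toSphere) *
        ∫⁻ r : Set.Ioi (0 : ℝ), A.indicator 1 r.1 * ENNReal.ofReal (gaussianDensity n v r)
          ∂(Measure.volumeIoiPow (2 * n - 1)) := by
    intro A S hA hS
    rw [← lintegral_norm_mul_shape n
      (g := fun r => A.indicator 1 r * ENNReal.ofReal (gaussianDensity n v r))
      ((measurable_one.indicator hA).mul (measurable_gaussianDensity n v).ennreal_ofReal)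
      (measurable_one.indicator hS) hn,
      complexGaussianVec_eq_withDensity n hv,
      withDensity_apply _ ((measurable_norm hA).inter (measurable_shape hS)),
      ← lintegral_indicator ((measurable_norm hA).inter (measurable_shape hS))]
    refine lintegral_congr fun z => ?_
    by_cases h1 : ‖z‖ ∈ A <;> by_cases h2 : shape z ∈ S <;> simp [h1, h2, Set.indicator]
  rw [indepFun_iff_measure_inter_preimage_eq_mul]
  intro A S hA hS
  have hA' := key A Set.univ hA .univ
  have hS' := key Set.univ S .univ hS
  have hU := key Set.univ Set.univ .univ .univ
  simp only [Set.preimage_univ, Set.inter_univ, Set.univ_inter, measure_univ] at hA' hS' hU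
  rw [key A S hA hS, hA', hS']
  -- The spherical and radial factors are not normalized separately; the product of their total
  -- masses is `1` by `hU`, and inserting it supplies the missing factors.
  refine (one_mul _).symm.trans ?_
  rw [hU]
  ring

-- Optimal beamforming gain.

/-- The maximal value attained by an orthogonal cognitive beamformer. -/
theorem IsOCB.norm_inner_sq {n : ℕ} {q s f : EuclideanSpace ℂ (Fin n)} {P : ℝ} (hq : ‖q‖ = 1)
    (hP : 0 ≤ P) (hf : IsOCB q s P f) :
    ‖inner ℂ f s‖ ^ 2 = P * (‖s‖ ^ 2 - ‖inner ℂ q s‖ ^ 2) := by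
  obtain ⟨⟨hf0, hfP⟩, hmax⟩ := hf
  -- For feasible `f` only the component of `s` orthogonal to `q` matters, so the bound is
  -- Cauchy–Schwarz against `p`.
  let p := s - inner ℂ q s • q
  have hpq : inner ℂ p q = 0 := by
    simp only [p, inner_sub_left, inner_smul_left, inner_conj_symm]
    rw [inner_self_eq_norm_sq_to_K, hq]
    simp
  have hred : ∀ g : EuclideanSpace ℂ (Fin n), inner ℂ g q = 0 → inner ℂ g s = inner ℂ g p := by
    intro g hg
    simp only [p, inner_sub_right, inner_smul_right, hg, mul_zero, sub_zero]
  have hps : inner ℂ p s = ((‖p‖ ^ 2 : ℝ) : ℂ) := by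
    rw [hred p hpq, inner_self_eq_norm_sq_to_K]
    simp
  have hpn : ‖p‖ ^ 2 = ‖s‖ ^ 2 - ‖inner ℂ q s‖ ^ 2 := by
    have h1 : s = p + inner ℂ q s • q := by simp [p]
    have h2 : inner ℂ p (inner ℂ q s • q) = 0 := by rw [inner_smul_right, hpq, mul_zero]
    have h3 := norm_add_sq_eq_norm_sq_add_norm_sq_of_inner_eq_zero p _ h2
    rw [← h1, norm_smul, hq, mul_one] at h3
    linarith [h3, sq ‖s‖, sq ‖p‖, sq ‖inner ℂ q s‖]
  rw [← hpn]
  apply le_antisymm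
  · rw [hred f hf0]
    calc ‖inner ℂ f p‖ ^ 2 ≤ (‖f‖ * ‖p‖) ^ 2 := by
          gcongr
          exact norm_inner_le_norm f p
      _ = ‖f‖ ^ 2 * ‖p‖ ^ 2 := by ring
      _ ≤ P * ‖p‖ ^ 2 := by gcongr
  · rcases eq_or_ne ‖p‖ 0 with h0 | h0
    · rw [h0]
      simp
    -- Equality in Cauchy–Schwarz: compare with the multiple of `p` that uses all the power `P`.
    · have hg := hmax (a := ((Real.sqrt P / ‖p‖ : ℝ) : ℂ) • p) ⟨by
        rw [inner_smul_left, hpq, mul_zero], by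
        rw [norm_smul, Complex.norm_real, Real.norm_of_nonneg (by positivity),
          div_mul_cancel₀ _ h0, Real.sq_sqrt hP]⟩
      simp only [Set.mem_ofPred_eq, inner_smul_left, hps, Complex.conj_ofReal, norm_mul,
        Complex.norm_real] at hg
      rw [Real.norm_of_nonneg (by positivity), Real.norm_of_nonneg (by positivity)] at hg
      refine le_trans (le_of_eq ?_) hg
      rw [mul_pow, div_pow, Real.sq_sqrt hP]
      field_simp

theorem quantError_nonneg {n : ℕ} {q s : EuclideanSpace ℂ (Fin n)} (hq : ‖q‖ = 1) (hs : ‖s‖ = 1) :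
    0 ≤ quantError q s := by
  have h := norm_inner_le_norm (𝕜 := ℂ) q s
  rw [hq, hs, mul_one] at h
  have := pow_le_one₀ (n := 2) (norm_nonneg _) h
  unfold quantError
  linarith

-- Law of the quantization error.

/-- The uniform distribution on the unit interval. -/
noncomputable def unitUniform : Measure ℝ := volume.restrict (Set.Ioc 0 1)

instance : IsProbabilityMeasure unitUniform := ⟨by simp [unitUniform]⟩

/-- The law of `δ * u ^ (1 / n)` for a uniform variable `u`. -/
noncomputable def powerLaw (n : ℕ) (δ : ℝ) : Measure ℝ :=
  unitUniform.map fun u => δ * u ^ (n : ℝ)⁻¹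

instance (n : ℕ) (δ : ℝ) : IsProbabilityMeasure (powerLaw n δ) :=
  Measure.isProbabilityMeasure_map (by fun_prop)

theorem powerLaw_Iic {n : ℕ} (hn : 0 < n) {δ : ℝ} (hδ : 0 < δ) {τ : ℝ} (h0 : 0 ≤ τ) (h1 : τ ≤ δ) :
    powerLaw n δ (Set.Iic τ) = ENNReal.ofReal ((τ / δ) ^ n) := by
  have hn' : (0 : ℝ) < n := by exact_mod_cast hn
  have hs : (fun u : ℝ => δ * u ^ (n : ℝ)⁻¹) ⁻¹' Set.Iic τ ∩ Set.Ioc 0 1 =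
      Set.Ioc 0 ((τ / δ) ^ n) := by
    have hle : (τ / δ) ^ n ≤ 1 := pow_le_one₀ (by positivity) ((div_le_one hδ).mpr h1)
    ext u
    have key : 0 < u → (δ * u ^ (n : ℝ)⁻¹ ≤ τ ↔ u ≤ (τ / δ) ^ n) := by
      intro hu
      rw [← Real.rpow_natCast (τ / δ), ← Real.rpow_inv_le_iff_of_pos hu.le (by positivity) hn',
        le_div_iff₀ hδ, mul_comm]
    simp only [Set.mem_inter_iff, Set.mem_preimage, Set.mem_Iic, Set.mem_Ioc]
    constructor
    · rintro ⟨h, hu, -⟩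
      exact ⟨hu, (key hu).1 h⟩
    · rintro ⟨hu, h⟩
      exact ⟨(key hu).2 h, hu, h.trans hle⟩
  have hm : Measurable fun u : ℝ => δ * u ^ (n : ℝ)⁻¹ := by fun_prop
  rw [powerLaw, Measure.map_apply hm measurableSet_Iic, unitUniform,
    Measure.restrict_apply (hm measurableSet_Iic), hs, Real.volume_Ioc, sub_zero]

/-- The values on `[0, δ]` already include `0` at `0` and `1` at `δ`, so monotonicity determines the
distribution function everywhere else. -/
theorem eq_powerLaw {n : ℕ} (hn : 0 < n) {δ : ℝ} (hδ : 0 < δ) {ν : Measure ℝ}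
    [IsProbabilityMeasure ν]
    (h : ∀ τ, 0 ≤ τ → τ ≤ δ → ν.real (Set.Iic τ) = (τ / δ) ^ n) : ν = powerLaw n δ := by
  have hν : ∀ τ, 0 ≤ τ → τ ≤ δ → ν (Set.Iic τ) = powerLaw n δ (Set.Iic τ) := by
    intro τ h0 h1
    rw [powerLaw_Iic hn hδ h0 h1, ← h τ h0 h1, ofReal_measureReal]
  refine Measure.ext_of_Iic _ _ fun τ => ?_
  have hz : powerLaw n δ (Set.Iic 0) = 0 := by
    rw [powerLaw_Iic hn hδ le_rfl hδ.le]
    simp [hn.ne']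
  have ho : powerLaw n δ (Set.Iic δ) = 1 := by
    rw [powerLaw_Iic hn hδ hδ.le le_rfl]
    simp [hδ.ne']
  rcases lt_or_ge τ 0 with h0 | h0
  · have hs : Set.Iic τ ⊆ Set.Iic 0 := Set.Iic_subset_Iic.mpr h0.le
    rw [measure_mono_null hs hz, measure_mono_null hs ((hν 0 le_rfl hδ.le).trans hz)]
  · rcases le_total τ δ with h1 | h1
    · exact hν τ h0 h1
    · have hs : Set.Iic δ ⊆ Set.Iic τ := Set.Iic_subset_Iic.mpr h1
      have e : ∀ μ : Measure ℝ, IsProbabilityMeasure μ → μ (Set.Iic δ) = 1 → μ (Set.Iic τ) = 1 :=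
        fun μ _ hμ => le_antisymm prob_le_one (hμ.symm.le.trans (measure_mono hs))
      rw [e _ inferInstance ho, e ν inferInstance ((hν δ hδ.le le_rfl).trans ho)]

/-- The decay factor `2 ^ (-B / n)` of the quantization error. -/
noncomputable def decay (n B : ℕ) : ℝ := (2 : ℝ) ^ (-(B : ℝ) / n)

theorem decay_pos (n B : ℕ) : 0 < decay n B := by unfold decay; positivity

theorem decay_pow {n : ℕ} (hn : 0 < n) (B : ℕ) : decay n B ^ n = (2 ^ B)⁻¹ := by
  have hn' : (n : ℝ) ≠ 0 := by positivity
  rw [decay, ← Real.rpow_natCast, ← Real.rpow_mul two_pos.le, div_mul_cancel₀ _ hn',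
    Real.rpow_neg two_pos.le, Real.rpow_natCast]

/-- The law of the product of a `Gamma(n + 1)` variable and an independent variable `u ^ (1 / n)`
with `u` uniform. -/
noncomputable def leakageLaw (n : ℕ) : Measure ℝ :=
  ((gammaMeasure (n + 1 : ℕ) 1).prod unitUniform).map fun p => p.1 * p.2 ^ (n : ℝ)⁻¹

instance (n : ℕ) : IsProbabilityMeasure (gammaMeasure (n + 1 : ℕ) 1) :=
  isProbabilityMeasure_gammaMeasure (by positivity) one_pos

instance (n : ℕ) : IsProbabilityMeasure (leakageLaw n) :=
  Measure.isProbabilityMeasure_map (by fun_prop)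

-- Joint law of primary gain, leakage and effective secondary gain.

namespace SystemModel

variable {Ω 𝒰 : Type*} [MeasurableSpace Ω] [MeasurableSpace 𝒰]
  {μ : Measure Ω} {n : ℕ} {lam : ℝ} {B : ℕ} (M : SystemModel (𝒰 := 𝒰) μ (n + 1) lam B)

theorem measurable_sxHat : Measurable M.sxHat :=
  M.measurable_Q.comp ((measurable_shape.comp M.measurable_hx).prodMk M.measurable_U)

theorem measurable_quantError {X : Type*} [MeasurableSpace X] {L : ℕ}
    {f g : X → EuclideanSpace ℂ (Fin L)} (hf : Measurable f) (hg : Measurable g) :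
    Measurable fun x => quantError (f x) (g x) := by
  unfold quantError
  fun_prop

theorem map_quantError [IsProbabilityMeasure μ] (hn : 0 < n) :
    μ.map (fun ω => quantError (M.sxHat ω) (shape (M.hx ω))) = powerLaw n (decay n B) := by
  have hm : Measurable fun ω => quantError (M.sxHat ω) (shape (M.hx ω)) :=
    measurable_quantError M.measurable_sxHat (measurable_shape.comp M.measurable_hx)
  have := Measure.isProbabilityMeasure_map (μ := μ) hm.aemeasurable
  refine eq_powerLaw hn (decay_pos n B) fun τ h0 h1 => ?_
  rw [map_measureReal_apply hm measurableSet_Iic]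
  have h := M.quantError_cdf τ h0 (h1.trans_eq (by simp [decay]))
  rw [div_pow, decay_pow hn, div_inv_eq_mul, mul_comm]
  exact h

theorem measurePreserving_hx_U [IsProbabilityMeasure μ] :
    MeasurePreserving (fun ω => (M.hx ω, M.U ω)) μ
      ((complexGaussianVec (n + 1) lam).prod (μ.map M.U)) := by
  have h : IndepFun M.hx M.U μ := M.indep_hx.comp (ψ := Prod.snd) measurable_id measurable_snd
  refine ⟨M.measurable_hx.prodMk M.measurable_U, ?_⟩
  rw [(indepFun_iff_map_prod_eq_prod_map_map M.measurable_hx.aemeasurable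
    M.measurable_U.aemeasurable).1 h, M.law_hx]

/-- The factors are grouped so that the leakage and the codeword are functions of the first one and
`hs` is independent of both. -/
theorem measurePreserving_hx_U_hs [IsProbabilityMeasure μ] :
    MeasurePreserving (fun ω => ((M.hx ω, M.U ω), M.hs ω)) μ
      (((complexGaussianVec (n + 1) lam).prod (μ.map M.U)).prod (complexGaussianVec (n + 1) 1)) := by
  have := Measure.isProbabilityMeasure_map (μ := μ) M.measurable_U.aemeasurable
  have h1 : MeasurePreserving (fun ω => (M.hs ω, M.U ω)) μ
      ((complexGaussianVec (n + 1) 1).prod (μ.map M.U)) := by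
    refine ⟨M.measurable_hs.prodMk M.measurable_U, ?_⟩
    rw [(indepFun_iff_map_prod_eq_prod_map_map M.measurable_hs.aemeasurable
      M.measurable_U.aemeasurable).1 M.indep_hs, M.law_hs]
  have h2 : MeasurePreserving (fun ω => (M.hx ω, (M.hs ω, M.U ω))) μ
      ((complexGaussianVec (n + 1) lam).prod
        ((complexGaussianVec (n + 1) 1).prod (μ.map M.U))) := by
    refine ⟨M.measurable_hx.prodMk h1.measurable, ?_⟩
    rw [(indepFun_iff_map_prod_eq_prod_map_map M.measurable_hx.aemeasurable
      h1.measurable.aemeasurable).1 M.indep_hx, M.law_hx, h1.map_eq]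
  have h3 := (MeasurePreserving.id (complexGaussianVec (n + 1) lam)).prod
    (Measure.measurePreserving_swap (μ := complexGaussianVec (n + 1) 1) (ν := μ.map M.U))
  exact ((measurePreserving_prodAssoc (complexGaussianVec (n + 1) lam) (μ.map M.U)
    (complexGaussianVec (n + 1) 1)).symm.comp h3).comp h2

/-- The interference leakage `g_x ε` as a function of the channel and the quantizer randomness. -/
noncomputable def leakage (p : EuclideanSpace ℂ (Fin (n + 1)) × 𝒰) : ℝ :=
  ‖p.1‖ ^ 2 / lam * quantError (M.Q (shape p.1) p.2) (shape p.1)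

theorem measurable_quantizedShape :
    Measurable fun p : EuclideanSpace ℂ (Fin (n + 1)) × 𝒰 => M.Q (shape p.1) p.2 :=
  M.measurable_Q.comp ((measurable_shape.comp measurable_fst).prodMk measurable_snd)

/-- The gain is a function of the norm, and the error a function of the shape and `U`; independence
of norm and shape makes the leakage a product of independent variables. -/
theorem measurePreserving_leakage [IsProbabilityMeasure μ] (hn : 0 < n) (hlam : 0 < lam) :
    MeasurePreserving M.leakage ((complexGaussianVec (n + 1) lam).prod (μ.map M.U))
      ((leakageLaw n).map (decay n B * ·)) := by
  have := Measure.isProbabilityMeasure_map (μ := μ) M.measurable_U.aemeasurable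
  let P := complexGaussianVec (n + 1) lam
  have hnorm : Measurable fun h : EuclideanSpace ℂ (Fin (n + 1)) => ‖h‖ := measurable_norm
  have hgain : Measurable fun r : ℝ => r ^ 2 / lam := by fun_prop
  have hPn := Measure.isProbabilityMeasure_map (μ := P) hnorm.aemeasurable
  have hPs := Measure.isProbabilityMeasure_map (μ := P) measurable_shape.aemeasurable
  let e : EuclideanSpace ℂ (Fin (n + 1)) × 𝒰 → ℝ := fun p => quantError (M.Q p.1 p.2) p.1
  have he : Measurable e := measurable_quantError M.measurable_Q measurable_fst
  have h1 : MeasurePreserving (fun h => (‖h‖, shape h)) P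
      ((P.map fun h => ‖h‖).prod (P.map shape)) :=
    ⟨hnorm.prodMk measurable_shape, (indepFun_iff_map_prod_eq_prod_map_map hnorm.aemeasurable
      measurable_shape.aemeasurable).1 (indepFun_norm_shape n.succ_pos hlam)⟩
  have h2 : MeasurePreserving (fun p : EuclideanSpace ℂ (Fin (n + 1)) × 𝒰 =>
      (‖p.1‖, (shape p.1, p.2))) (P.prod (μ.map M.U))
      ((P.map fun h => ‖h‖).prod ((P.map shape).prod (μ.map M.U))) :=
    (measurePreserving_prodAssoc _ _ _).comp (h1.prod (MeasurePreserving.id (μ.map M.U)))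
  have h3 : MeasurePreserving (fun p : EuclideanSpace ℂ (Fin (n + 1)) × 𝒰 =>
      (‖p.1‖ ^ 2 / lam, quantError (M.Q (shape p.1) p.2) (shape p.1))) (P.prod (μ.map M.U))
      (((P.map fun h => ‖h‖).map fun r => r ^ 2 / lam).prod
        (((P.map shape).prod (μ.map M.U)).map e)) :=
    ((hgain.measurePreserving _).prod (he.measurePreserving _)).comp h2
  have hgam : (P.map fun h => ‖h‖).map (fun r => r ^ 2 / lam) = gammaMeasure (n + 1 : ℕ) 1 := by
    rw [Measure.map_map hgain hnorm]
    exact map_norm_sq_complexGaussianVec n.succ_pos hlam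
  have hPe := Measure.isProbabilityMeasure_map (μ := (P.map shape).prod (μ.map M.U)) he.aemeasurable
  -- The law of the error on the product space is read off on `Ω`, where the system model prescribes
  -- it.
  have heps : ((P.map shape).prod (μ.map M.U)).map e = powerLaw n (decay n B) := by
    rw [hgam] at h3
    have h4 := (measurePreserving_snd.comp h3).comp M.measurePreserving_hx_U
    rw [← h4.map_eq]
    exact M.map_quantError hn
  rw [hgam, heps] at h3
  have h5 : MeasurePreserving (fun p : ℝ × ℝ => p.1 * p.2)
      ((gammaMeasure (n + 1 : ℕ) 1).prod (powerLaw n (decay n B)))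
      ((leakageLaw n).map (decay n B * ·)) := by
    refine ⟨by fun_prop, ?_⟩
    have h6 : MeasurePreserving (fun u : ℝ => decay n B * u ^ (n : ℝ)⁻¹) unitUniform
        (powerLaw n (decay n B)) := ⟨by fun_prop, rfl⟩
    have h7 := (MeasurePreserving.id (gammaMeasure (n + 1 : ℕ) 1)).prod h6
    rw [← h7.map_eq, Measure.map_map (by fun_prop) h7.measurable, leakageLaw,
      Measure.map_map (by fun_prop) (by fun_prop)]
    congr 1
    ext p
    simp only [Function.comp, Prod.map, id]
    ring
  exact h5.comp h3

/-- The effective secondary channel power orthogonal to the quantized interference channel. -/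
noncomputable def orthGain (ω : Ω) : ℝ := ‖M.hs ω‖ ^ 2 - ‖inner ℂ (M.sxHat ω) (M.hs ω)‖ ^ 2

theorem measurable_orthGain : Measurable M.orthGain := by
  have := M.measurable_hs
  have := M.measurable_sxHat
  unfold orthGain
  fun_prop

/-- Given `hx` and `U`, the orthogonal gain is Gamma(`n`) whatever the codeword. A skew product with
constant fibre law is a direct product, hence independence. -/
theorem measurePreserving_leakage_orthGain [IsProbabilityMeasure μ] (hn : 0 < n) (hlam : 0 < lam) :
    MeasurePreserving (fun ω => (M.leakage (M.hx ω, M.U ω), M.orthGain ω)) μ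
      (((leakageLaw n).map (decay n B * ·)).prod (gammaMeasure n 1)) := by
  have := Measure.isProbabilityMeasure_map (μ := μ) M.measurable_U.aemeasurable
  suffices key : MeasurePreserving
      (fun p : (EuclideanSpace ℂ (Fin (n + 1)) × 𝒰) × EuclideanSpace ℂ (Fin (n + 1)) =>
        (M.leakage p.1, ‖p.2‖ ^ 2 - ‖inner ℂ (M.Q (shape p.1.1) p.1.2) p.2‖ ^ 2))
      (((complexGaussianVec (n + 1) lam).prod (μ.map M.U)).prod (complexGaussianVec (n + 1) 1))
      (((leakageLaw n).map (decay n B * ·)).prod (gammaMeasure n 1)) by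
    have h := key.comp M.measurePreserving_hx_U_hs
    simp only [Function.comp_def] at h
    simpa only [orthGain, sxHat] using h
  refine (M.measurePreserving_leakage hn hlam).skew_product
    (g := fun p h => ‖h‖ ^ 2 - ‖inner ℂ (M.Q (shape p.1) p.2) h‖ ^ 2) ?_ ?_
  · have hr : Measurable fun q : (EuclideanSpace ℂ (Fin (n + 1)) × 𝒰) ×
        EuclideanSpace ℂ (Fin (n + 1)) => q.1 := measurable_fst
    have h := M.measurable_quantizedShape.comp hr
    have h' : Measurable (Function.uncurry fun (p : EuclideanSpace ℂ (Fin (n + 1)) × 𝒰)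
      (h : EuclideanSpace ℂ (Fin (n + 1))) => inner ℂ (M.Q (shape p.1) p.2) h) :=
      h.inner measurable_snd
    exact (measurable_snd.norm.pow_const 2).sub (h'.norm.pow_const 2)
  -- The codeword is known to be a unit vector only when the shape is, so the null event `hx = 0` is
  -- discarded.
  · have h := (measurePreserving_fst (μ := complexGaussianVec (n + 1) lam) (ν := μ.map M.U)).quasiMeasurePreserving.ae
      (ae_ne_zero_complexGaussianVec n.succ_pos hlam)
    filter_upwards [h] with p hp
    exact map_orthogonal_complexGaussianVec hn (M.norm_Q _ _ (norm_shape hp))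

theorem measurePreserving_gp_leakage_orthGain [IsProbabilityMeasure μ] (hn : 0 < n) (hlam : 0 < lam) :
    MeasurePreserving (fun ω => (M.gp ω, (M.leakage (M.hx ω, M.U ω), M.orthGain ω))) μ
      ((expMeasure 1).prod (((leakageLaw n).map (decay n B * ·)).prod (gammaMeasure n 1))) := by
  have h := M.measurePreserving_leakage_orthGain hn hlam
  have hF : Measurable fun p : EuclideanSpace ℂ (Fin (n + 1)) × EuclideanSpace ℂ (Fin (n + 1)) × 𝒰 =>
      (M.leakage (p.1, p.2.2),
        ‖p.2.1‖ ^ 2 - ‖inner ℂ (M.Q (shape p.1) p.2.2) p.2.1‖ ^ 2) := by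
    have hr : Measurable fun p : EuclideanSpace ℂ (Fin (n + 1)) × EuclideanSpace ℂ (Fin (n + 1)) × 𝒰 =>
      (p.1, p.2.2) := by fun_prop
    have h' : Measurable fun p : EuclideanSpace ℂ (Fin (n + 1)) × EuclideanSpace ℂ (Fin (n + 1)) × 𝒰 =>
      inner ℂ (M.Q (shape p.1) p.2.2) p.2.1 :=
      (M.measurable_quantizedShape.comp hr).inner (by fun_prop)
    exact ((M.measurePreserving_leakage hn hlam).measurable.comp hr).prodMk
      (((measurable_fst.comp measurable_snd).norm.pow_const 2).sub (h'.norm.pow_const 2))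
  have hi := M.indep_gp.comp measurable_id hF
  refine ⟨M.measurable_gp.prodMk h.measurable, ?_⟩
  have := (indepFun_iff_map_prod_eq_prod_map_map M.measurable_gp.aemeasurable
    h.measurable.aemeasurable).1 hi
  rw [this, M.law_gp, h.map_eq]

end SystemModel

-- Probability of the limiting outage event.

theorem expMeasure_real_Icc {s t : ℝ} (hs : 0 ≤ s) (hst : s ≤ t) :
    (expMeasure 1).real (Set.Icc s t) = Real.exp (-s) - Real.exp (-t) := by
  have := isProbabilityMeasure_expMeasure one_pos
  have hna : NullSingletonClass (expMeasure 1) := by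
    unfold expMeasure gammaMeasure
    infer_instance
  have h : ∀ x, 0 ≤ x → (expMeasure 1).real (Set.Iic x) = 1 - Real.exp (-x) := by
    intro x hx
    rw [← cdf_eq_real, cdf_expMeasure_eq one_pos, if_pos hx, one_mul]
  rw [measureReal_congr Ioc_ae_eq_Icc.symm, ← Set.Iic_sdiff_Iic,
    measureReal_sdiff (Set.Iic_subset_Iic.mpr hst) measurableSet_Iic, h s hs,
    h t (hs.trans hst)]
  ring

theorem ae_pos_gammaMeasure {a : ℝ} : ∀ᵐ x ∂(gammaMeasure a 1), 0 < x := by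
  have hm : Measurable (gammaPDF a 1) := (measurable_gammaPDFReal a 1).ennreal_ofReal
  rw [gammaMeasure, ae_withDensity_iff hm]
  have h0 : ∀ᵐ x : ℝ, x ≠ 0 := by
    exact compl_mem_ae_iff.mpr (measure_singleton 0)
  filter_upwards [h0] with x hx h
  by_contra hneg
  exact h (gammaPDF_of_neg (lt_of_le_of_ne (not_lt.mp hneg) hx))

theorem ae_pos_unitUniform : ∀ᵐ u ∂unitUniform, 0 < u :=
  (ae_restrict_mem measurableSet_Ioc).mono fun _ h => h.1

theorem ae_pos_leakageLaw (n : ℕ) : ∀ᵐ w ∂(leakageLaw n), 0 < w := by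
  rw [leakageLaw, ae_map_iff (by fun_prop) measurableSet_Ioi]
  have h1 := (measurePreserving_fst (μ := gammaMeasure (n + 1 : ℕ) 1)
    (ν := unitUniform)).quasiMeasurePreserving.ae ae_pos_gammaMeasure
  have h2 := (measurePreserving_snd (μ := gammaMeasure (n + 1 : ℕ) 1)
    (ν := unitUniform)).quasiMeasurePreserving.ae ae_pos_unitUniform
  filter_upwards [h1, h2] with p hp1 hp2
  positivity

/-- The limit of the outage event, in terms of the primary channel power, the interference leakage
and the effective secondary channel power. -/
def outageSet (a κ : ℝ) : Set (ℝ × ℝ × ℝ) :=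
  {p | 0 ≤ p.1 / a - 1 ∧ p.2.2 * (p.1 / a - 1) ≤ κ * p.2.1}

theorem measurableSet_outageSet (a κ : ℝ) : MeasurableSet (outageSet a κ) :=
  (measurableSet_le (f := fun _ : ℝ × ℝ × ℝ => (0 : ℝ)) (g := fun p => p.1 / a - 1)
    (by fun_prop) (by fun_prop)).inter
    (measurableSet_le (f := fun p : ℝ × ℝ × ℝ => p.2.2 * (p.1 / a - 1)) (g := fun p => κ * p.2.1)
      (by fun_prop) (by fun_prop))

/-- For fixed leakage and secondary gain, the event says that the exponential variable lies in the
interval from `a` to `a + a κ y / g`. -/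
theorem expMeasure_real_outageSet_slice {a κ y g : ℝ} (ha : 0 < a) (hκ : 0 < κ) (hy : 0 < y)
    (hg : 0 < g) :
    (expMeasure 1).real ((fun x => (x, (y, g))) ⁻¹' outageSet a κ) =
      Real.exp (-a) * (1 - Real.exp (-(a * κ * (y / g)))) := by
  have hs : (fun x => (x, (y, g))) ⁻¹' outageSet a κ = Set.Icc a (a + a * κ * (y / g)) := by
    ext x
    simp only [outageSet, Set.mem_preimage, Set.mem_ofPred_eq, Set.mem_Icc, sub_nonneg,
      one_le_div ha]
    refine and_congr_right fun _ => ?_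
    rw [← le_div_iff₀' hg, sub_le_iff_le_add, div_le_iff₀ ha]
    ring_nf
  rw [hs, expMeasure_real_Icc ha.le (by
    have : 0 < a * κ * (y / g) := by positivity
    linarith), neg_add, Real.exp_add]
  ring

/-- The expectation of `1 - exp (-t W / G)` for independent `W` and `G`. -/
noncomputable def meanOutage (n : ℕ) (t : ℝ) : ℝ :=
  ∫ p, (1 - Real.exp (-(t * (p.1 / p.2)))) ∂((leakageLaw n).prod (gammaMeasure n 1))

theorem prod_real_outageSet {n : ℕ} (hn : 0 < n) {a κ δ : ℝ} (ha : 0 < a) (hκ : 0 < κ) (hδ : 0 < δ) :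
    ((expMeasure 1).prod (((leakageLaw n).map (δ * ·)).prod (gammaMeasure n 1))).real
      (outageSet a κ) = Real.exp (-a) * meanOutage n (a * κ * δ) := by
  have := isProbabilityMeasure_expMeasure one_pos
  have := isProbabilityMeasure_gammaMeasure (a := n) (by exact_mod_cast hn) one_pos
  have hmp : MeasurePreserving (fun p : ℝ × ℝ => (δ * p.1, p.2))
      ((leakageLaw n).prod (gammaMeasure n 1))
      (((leakageLaw n).map (δ * ·)).prod (gammaMeasure n 1)) :=
    MeasurePreserving.prod ⟨by fun_prop, rfl⟩ (MeasurePreserving.id _)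
  have hprob := Measure.isProbabilityMeasure_map (μ := leakageLaw n) (f := (δ * ·)) (by fun_prop)
  have hmeas := measurable_measure_prodMk_right (μ := expMeasure 1) (measurableSet_outageSet a κ)
  rw [measureReal_def, Measure.prod_apply_symm (measurableSet_outageSet a κ),
    ← hmp.lintegral_comp hmeas,
    ← integral_toReal (f := fun p : ℝ × ℝ =>
      expMeasure 1 ((fun x => (x, (δ * p.1, p.2))) ⁻¹' outageSet a κ))
      (hmeas.comp hmp.measurable).aemeasurable (ae_of_all _ fun _ => measure_lt_top _ _),
    meanOutage, ← integral_const_mul]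
  refine integral_congr_ae ?_
  have h1 := (measurePreserving_fst (μ := leakageLaw n)
    (ν := gammaMeasure n 1)).quasiMeasurePreserving.ae (ae_pos_leakageLaw n)
  have h2 := (measurePreserving_snd (μ := leakageLaw n)
    (ν := gammaMeasure n 1)).quasiMeasurePreserving.ae ae_pos_gammaMeasure
  filter_upwards [h1, h2] with p hp1 hp2
  rw [← measureReal_def, expMeasure_real_outageSet_slice ha hκ (by positivity) hp2]
  ring_nf

-- The limit of unbounded transmit power.

namespace SystemModel

variable {Ω 𝒰 : Type*} [MeasurableSpace Ω] [MeasurableSpace 𝒰]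
  {μ : Measure Ω} {n : ℕ} {lam : ℝ} {B : ℕ} (M : SystemModel (𝒰 := 𝒰) μ (n + 1) lam B)

theorem ae_pos_leakage [IsProbabilityMeasure μ] (hn : 0 < n) (hlam : 0 < lam) :
    ∀ᵐ ω ∂μ, 0 < M.leakage (M.hx ω, M.U ω) := by
  have h := (M.measurePreserving_leakage hn hlam).comp M.measurePreserving_hx_U
  refine h.quasiMeasurePreserving.ae ?_
  rw [ae_map_iff (by fun_prop) measurableSet_Ioi]
  filter_upwards [ae_pos_leakageLaw n] with w hw
  have := decay_pos n B
  positivity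

theorem ae_pos_orthGain [IsProbabilityMeasure μ] (hn : 0 < n) (hlam : 0 < lam) :
    ∀ᵐ ω ∂μ, 0 < M.orthGain ω := by
  have := isProbabilityMeasure_gammaMeasure (a := n) (by exact_mod_cast hn) one_pos
  have := Measure.isProbabilityMeasure_map (μ := leakageLaw n) (f := (decay n B * ·)) (by fun_prop)
  exact (measurePreserving_snd.comp
    (M.measurePreserving_leakage_orthGain hn hlam)).quasiMeasurePreserving.ae ae_pos_gammaMeasure

theorem ae_hx_ne_zero (hlam : 0 < lam) : ∀ᵐ ω ∂μ, M.hx ω ≠ 0 := by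
  have h : MeasurePreserving M.hx μ (complexGaussianVec (n + 1) lam) := ⟨M.measurable_hx, M.law_hx⟩
  exact h.quasiMeasurePreserving.ae (ae_ne_zero_complexGaussianVec n.succ_pos hlam)

theorem ae_hs_ne_zero : ∀ᵐ ω ∂μ, M.hs ω ≠ 0 := by
  have h : MeasurePreserving M.hs μ (complexGaussianVec (n + 1) 1) := ⟨M.measurable_hs, M.law_hs⟩
  exact h.quasiMeasurePreserving.ae (ae_ne_zero_complexGaussianVec n.succ_pos one_pos)

theorem measurable_suPower (σ2 γp θp Pmax : ℝ) : Measurable (M.suPower σ2 γp θp Pmax) := by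
  have hq : Measurable fun ω => quantError (M.sxHat ω) (shape (M.hx ω)) :=
    measurable_quantError M.measurable_sxHat (measurable_shape.comp M.measurable_hx)
  have hw : Measurable fun ω => interferenceMargin σ2 γp θp (M.gp ω) := by
    have := M.measurable_gp
    unfold interferenceMargin
    fun_prop
  have hx : Measurable M.gx := by
    have := M.measurable_hx
    unfold gx
    fun_prop
  have hi : Measurable fun ω => ipcSignal lam Pmax (interferenceMargin σ2 γp θp (M.gp ω)) (M.gx ω)
      (quantError (M.sxHat ω) (shape (M.hx ω))) := by
    unfold ipcSignal
    exact Measurable.ite (measurableSet_le measurable_const hw) (by fun_prop) measurable_const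
  unfold suPower powerBudget
  exact Measurable.ite ((measurableSet_le measurable_const hw).inter
    (measurableSet_lt hi measurable_const)) hi measurable_const

theorem suPower_nonneg (hlam : 0 < lam) {σ2 γp θp Pmax : ℝ} (hP : 0 ≤ Pmax) {ω : Ω}
    (hx : M.hx ω ≠ 0) : 0 ≤ M.suPower σ2 γp θp Pmax ω := by
  have hq : 0 ≤ quantError (M.sxHat ω) (shape (M.hx ω)) :=
    quantError_nonneg (M.norm_Q _ _ (norm_shape hx)) (norm_shape hx)
  unfold suPower powerBudget
  split_ifs with h
  · rw [ipcSignal, if_pos h.1]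
    have hg : 0 ≤ M.gx ω := by unfold gx; positivity
    exact div_nonneg h.1 (mul_nonneg (mul_nonneg hlam.le hg) hq)
  · exact hP

theorem snr_eq (hlam : 0 < lam) {σ2 γp θp Pmax : ℝ} (hP : 0 ≤ Pmax)
    {f : Ω → EuclideanSpace ℂ (Fin (n + 1))} {ω : Ω} (hx : M.hx ω ≠ 0) (hs : M.hs ω ≠ 0)
    (hf : IsOCB (M.sxHat ω) (shape (M.hs ω)) (M.suPower σ2 γp θp Pmax ω) (f ω)) :
    M.snr σ2 f ω = M.orthGain ω / σ2 * M.suPower σ2 γp θp Pmax ω := by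
  rw [snr, hf.norm_inner_sq (M.norm_Q _ _ (norm_shape hx)) (M.suPower_nonneg hlam hP hx),
    norm_shape hs, orthGain]
  change _ * (_ * (_ - ‖inner ℂ (M.sxHat ω) _‖ ^ 2)) = _
  have h : inner ℂ (M.sxHat ω) (M.hs ω) = ‖M.hs ω‖ * inner ℂ (M.sxHat ω) (shape (M.hs ω)) := by
    rw [← inner_smul_right, norm_smul_shape hs]
  rw [h, norm_mul, Complex.norm_real, norm_norm]
  ring

/-- For each outcome the outage event stabilizes once `Pmax` is large, which is the pointwise
convergence of indicators required below. -/
theorem eventually_outage_iff (hlam : 0 < lam) {σ2 γp θp θs : ℝ} (hσ : 0 < σ2) {ω : Ω}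
    (hθ : 0 < θp)
    (hy : 0 < M.leakage (M.hx ω, M.U ω)) (hG : 0 < M.orthGain ω) :
    ∀ᶠ Pmax : ℝ in atTop, M.orthGain ω / σ2 * M.suPower σ2 γp θp Pmax ω ≤ θs ↔
      (M.gp ω, (M.leakage (M.hx ω, M.U ω), M.orthGain ω)) ∈ outageSet (θp / γp) (lam * θs) := by
  set y := M.leakage (M.hx ω, M.U ω) with hydef
  set G := M.orthGain ω
  have hye : lam * M.gx ω * quantError (M.sxHat ω) (shape (M.hx ω)) = lam * y := by
    rw [hydef, leakage, gx, sxHat, mul_assoc]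
  have hw : interferenceMargin σ2 γp θp (M.gp ω) = σ2 * (M.gp ω / (θp / γp) - 1) := by
    rw [interferenceMargin]
    field_simp
  simp only [suPower, powerBudget, ipcSignal, hye, hw, outageSet, Set.mem_ofPred_eq]
  set w := M.gp ω / (θp / γp) - 1
  by_cases h : 0 ≤ w
  · have h' : 0 ≤ σ2 * w := by positivity
    -- Beyond this value the cap is inactive and the budget equals the fed-back signal; positive
    -- leakage makes it finite.
    filter_upwards [eventually_gt_atTop (σ2 * w / (lam * y))] with Pmax hP
    simp only [h, h', hP, if_true, and_self, true_and]
    rw [div_mul_div_comm, div_le_iff₀ (by positivity)]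
    constructor
    · intro h1
      refine le_of_mul_le_mul_left (a := σ2) ?_ hσ
      linarith
    · intro h1
      have := mul_le_mul_of_nonneg_left h1 hσ.le
      linarith
  · have h' : ¬ 0 ≤ σ2 * w := fun h1 => h (nonneg_of_mul_nonneg_right h1 hσ)
    -- Here the budget is `Pmax` itself, so a positive orthogonal gain eventually pushes the SNR
    -- above `θs`.
    filter_upwards [eventually_gt_atTop (θs / (G / σ2))] with Pmax hP
    simp only [h, h', false_and, if_false, iff_false, not_le]
    rwa [div_lt_iff₀' (by positivity)] at hP

theorem tendsto_outage [IsProbabilityMeasure μ] (hn : 0 < n) (hlam : 0 < lam) {σ2 γp θp θs : ℝ}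
    (hσ : 0 < σ2) (hγ : 0 < γp) (hθ : 0 < θp) (hθs : 0 < θs)
    (f : ℝ → Ω → EuclideanSpace ℂ (Fin (n + 1)))
    (hf : ∀ Pmax : ℝ, 0 < Pmax → M.IsBeamformer σ2 γp θp Pmax (f Pmax)) :
    Tendsto (fun Pmax : ℝ => M.outage σ2 θs (f Pmax)) atTop
      (𝓝 (Real.exp (-(θp / γp)) * meanOutage n (θp / γp * (lam * θs) * decay n B))) := by
  -- The beamformer is not assumed measurable; the true outage event is replaced by an almost
  -- everywhere equal measurable one.
  let A : ℝ → Set Ω := fun Pmax => {ω | M.orthGain ω / σ2 * M.suPower σ2 γp θp Pmax ω ≤ θs}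
  have hA : ∀ Pmax, MeasurableSet (A Pmax) := fun Pmax =>
    measurableSet_le ((M.measurable_orthGain.div_const _).mul (M.measurable_suPower _ _ _ _))
      measurable_const
  have hT := M.measurePreserving_gp_leakage_orthGain hn hlam
  have hlim := tendsto_measure_of_ae_tendsto_indicator_of_isFiniteMeasure (μ := μ) atTop
    (hT.measurable (measurableSet_outageSet (θp / γp) (lam * θs))) hA (by
      filter_upwards [M.ae_pos_leakage hn hlam, M.ae_pos_orthGain hn hlam] with ω hy hG
      exact M.eventually_outage_iff hlam hσ hθ hy hG)
  have hlim' := (ENNReal.tendsto_toReal (measure_ne_top μ _)).comp hlim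
  rw [hT.measure_preimage (measurableSet_outageSet _ _).nullMeasurableSet, ← measureReal_def,
    prod_real_outageSet hn (by positivity) (by positivity) (decay_pos n B)] at hlim'
  refine hlim'.congr' ?_
  filter_upwards [eventually_gt_atTop 0] with Pmax hP
  rw [outage, Function.comp, ← measureReal_def]
  refine measureReal_congr ?_
  filter_upwards [hf Pmax hP, M.ae_hx_ne_zero hlam, M.ae_hs_ne_zero] with ω hω hx hs
  refine propext ?_
  change _ ≤ θs ↔ M.snr σ2 (f Pmax) ω ≤ θs
  rw [M.snr_eq hlam hP.le hx hs hω]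

end SystemModel

-- Moments of the gamma and leakage laws.

theorem integral_rpow_gammaMeasure {a s : ℝ} (ha : 0 < a) (has : 0 < a + s) :
    ∫ x, x ^ s ∂(gammaMeasure a 1) = Real.Gamma (a + s) / Real.Gamma a := by
  rw [integral_gammaMeasure ha, Real.Gamma_eq_integral has, smul_eq_mul, div_eq_inv_mul]
  congr 1
  refine setIntegral_congr_fun measurableSet_Ioi fun x hx => ?_
  have hx' : (0 : ℝ) < x := hx
  simp only [smul_eq_mul]
  rw [show a + s - 1 = a - 1 + s by ring, Real.rpow_add hx']
  ring

/-- A nonzero Bochner integral forces integrability, and the quotient of Gamma values is positive.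
-/
theorem integrable_rpow_gammaMeasure {a s : ℝ} (ha : 0 < a) (has : 0 < a + s) :
    Integrable (fun x : ℝ => x ^ s) (gammaMeasure a 1) := by
  by_contra h
  have h1 := integral_rpow_gammaMeasure ha has
  rw [integral_undef h] at h1
  have := Real.Gamma_pos_of_pos ha
  have := Real.Gamma_pos_of_pos has
  exact absurd h1 (by positivity)

theorem integrable_inv_gammaMeasure {n : ℕ} (hn : 2 ≤ n) :
    Integrable (fun x : ℝ => x⁻¹) (gammaMeasure n 1) := by
  have hn' : (2 : ℝ) ≤ n := by exact_mod_cast hn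
  simpa [Real.rpow_neg_one] using
    integrable_rpow_gammaMeasure (a := n) (s := -1) (by linarith) (by linarith)

theorem integral_inv_gammaMeasure {n : ℕ} (hn : 2 ≤ n) :
    ∫ x : ℝ, x⁻¹ ∂(gammaMeasure n 1) = ((n : ℝ) - 1)⁻¹ := by
  have hn' : (2 : ℝ) ≤ n := by exact_mod_cast hn
  have h := integral_rpow_gammaMeasure (a := n) (s := -1) (by linarith) (by linarith)
  simp only [Real.rpow_neg_one] at h
  have h1 : (n : ℝ) - 1 ≠ 0 := by linarith
  have h2 := Real.Gamma_add_one h1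
  rw [sub_add_cancel] at h2
  have h3 : 0 < Real.Gamma ((n : ℝ) - 1) := Real.Gamma_pos_of_pos (by linarith)
  rw [h, h2, ← sub_eq_add_neg]
  field_simp

theorem integrable_unitUniform {f : ℝ → ℝ} (hf : Continuous f) : Integrable f unitUniform :=
  (hf.integrableOn_Icc (a := 0) (b := 1)).mono_set Set.Ioc_subset_Icc_self

theorem continuous_rpow_inv_natCast {n : ℕ} : Continuous fun u : ℝ => u ^ (n : ℝ)⁻¹ :=
  Real.continuous_rpow_const (by positivity)

theorem integral_unitUniform_rpow (n : ℕ) :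
    ∫ u, u ^ (n : ℝ)⁻¹ ∂unitUniform = ((n : ℝ)⁻¹ + 1)⁻¹ := by
  have h0 : (0 : ℝ) ≤ (n : ℝ)⁻¹ := by positivity
  rw [unitUniform, ← intervalIntegral.integral_of_le zero_le_one,
    integral_rpow (Or.inl (by linarith)), Real.one_rpow, Real.zero_rpow (by positivity)]
  simp

theorem integrable_sq_leakageLaw (n : ℕ) : Integrable (fun w => w ^ 2) (leakageLaw n) := by
  rw [leakageLaw, integrable_map_measure (by fun_prop) (by fun_prop)]
  have h1 : Integrable (fun x : ℝ => x ^ (2 : ℝ)) (gammaMeasure (n + 1 : ℕ) 1) :=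
    integrable_rpow_gammaMeasure (by positivity) (by positivity)
  have h2 := h1.mul_prod (integrable_unitUniform ((continuous_rpow_inv_natCast (n := n)).pow 2))
  refine h2.congr (ae_of_all _ fun p => ?_)
  simp only [Function.comp, Real.rpow_two, Pi.pow_apply]
  ring

theorem integrable_leakageLaw (n : ℕ) : Integrable (fun w => w) (leakageLaw n) := by
  have h : MemLp (fun w : ℝ => w) 2 (leakageLaw n) :=
    (memLp_two_iff_integrable_sq (by fun_prop)).2 (integrable_sq_leakageLaw n)
  exact h.integrable (by norm_num)

/-- The mean factors as `(n + 1) · n / (n + 1)`. -/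
theorem integral_leakageLaw {n : ℕ} (hn : 0 < n) : ∫ w, w ∂(leakageLaw n) = n := by
  rw [leakageLaw, integral_map (by fun_prop) (by fun_prop),
    integral_prod_mul (fun x : ℝ => x) (fun u : ℝ => u ^ (n : ℝ)⁻¹), integral_unitUniform_rpow]
  have hn' : (0 : ℝ) < n := by exact_mod_cast hn
  have h := integral_rpow_gammaMeasure (a := (n + 1 : ℕ)) (s := 1) (by positivity) (by positivity)
  simp only [Real.rpow_one] at h
  rw [h, Real.Gamma_add_one (by positivity), mul_div_assoc, div_self
    (Real.Gamma_pos_of_pos (by positivity)).ne']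
  push_cast
  field_simp
  ring

-- Small-parameter expansion of the mean outage.

/-- Combine `1 + y ≤ exp y` with `(1 - y + y²)(1 + y) = 1 + y³ ≥ 1`. -/
theorem exp_neg_le_quadratic {y : ℝ} (hy : 0 ≤ y) : Real.exp (-y) ≤ 1 - y + y ^ 2 := by
  rw [Real.exp_neg]
  refine inv_le_of_inv_le₀ (by nlinarith) ?_
  refine le_trans ?_ (Real.add_one_le_exp y)
  rw [inv_le_iff_one_le_mul₀ (by nlinarith)]
  nlinarith [pow_nonneg hy 3]

/-- The outage expansion error is bounded by the mean of any bound of `t W / G` and its square. -/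
theorem abs_meanOutage_sub_le {n : ℕ} (hn : 2 ≤ n) {t : ℝ} (ht : 0 ≤ t) {F : ℝ × ℝ → ℝ}
    (hF : Integrable F ((leakageLaw n).prod (gammaMeasure n 1)))
    (hbound : ∀ w g : ℝ, 0 < w → 0 < g → t * (w / g) ≤ F (w, g) ∨ (t * (w / g)) ^ 2 ≤ F (w, g)) :
    |meanOutage n t - n / ((n : ℝ) - 1) * t| ≤
      ∫ p, F p ∂((leakageLaw n).prod (gammaMeasure n 1)) := by
  have hn0 : 0 < n := by omega
  have := isProbabilityMeasure_gammaMeasure (a := n) (by exact_mod_cast hn0) one_pos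
  have hY : Integrable (fun p : ℝ × ℝ => p.1 / p.2) ((leakageLaw n).prod (gammaMeasure n 1)) := by
    simpa only [div_eq_mul_inv] using (integrable_leakageLaw n).mul_prod (integrable_inv_gammaMeasure hn)
  have hYi : ∫ p : ℝ × ℝ, p.1 / p.2 ∂((leakageLaw n).prod (gammaMeasure n 1)) = n / ((n : ℝ) - 1) := by
    simp only [div_eq_mul_inv]
    rw [integral_prod_mul (fun w : ℝ => w) (fun g : ℝ => g⁻¹), integral_leakageLaw hn0,
      integral_inv_gammaMeasure hn]
  have h1 := (measurePreserving_fst (μ := leakageLaw n)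
    (ν := gammaMeasure n 1)).quasiMeasurePreserving.ae (ae_pos_leakageLaw n)
  have h2 := (measurePreserving_snd (μ := leakageLaw n)
    (ν := gammaMeasure n 1)).quasiMeasurePreserving.ae ae_pos_gammaMeasure
  have hE : Integrable (fun p : ℝ × ℝ => 1 - Real.exp (-(t * (p.1 / p.2))))
      ((leakageLaw n).prod (gammaMeasure n 1)) := by
    refine (hY.const_mul t).mono (by fun_prop) ?_
    filter_upwards [h1, h2] with p hp1 hp2
    have hy : 0 ≤ t * (p.1 / p.2) := by positivity
    have he : Real.exp (-(t * (p.1 / p.2))) ≤ 1 := Real.exp_le_one_iff.mpr (by linarith)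
    rw [Real.norm_of_nonneg (by linarith), Real.norm_of_nonneg hy]
    linarith [Real.add_one_le_exp (-(t * (p.1 / p.2)))]
  rw [meanOutage, mul_comm (n / ((n : ℝ) - 1)), ← hYi, ← integral_const_mul,
    ← integral_sub hE (hY.const_mul t)]
  refine (abs_integral_le_integral_abs).trans (integral_mono_ae (hE.sub (hY.const_mul t)).abs hF ?_)
  filter_upwards [h1, h2] with p hp1 hp2
  have hy : 0 ≤ t * (p.1 / p.2) := by positivity
  -- With `y = t W / G`, these give `0 ≤ y - (1 - exp (-y)) ≤ min(y, y²)`; either alternative of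
  -- `hbound` then suffices at each point.
  have l1 := Real.add_one_le_exp (-(t * (p.1 / p.2)))
  have l2 := exp_neg_le_quadratic hy
  have l3 : Real.exp (-(t * (p.1 / p.2))) ≤ 1 := Real.exp_le_one_iff.mpr (by linarith)
  rw [abs_le]
  rcases hbound p.1 p.2 hp1 hp2 with h | h
  · constructor <;> linarith
  · constructor <;> linarith

/-- The quadratic bound works everywhere because a Gamma(`n`) variable has a finite moment of order
`-2` when `n > 2`. -/
theorem exists_abs_meanOutage_sub_le {n : ℕ} (hn : 3 ≤ n) :
    ∃ C : ℝ, ∀ t : ℝ, 0 ≤ t → |meanOutage n t - n / ((n : ℝ) - 1) * t| ≤ C * t ^ 2 := by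
  have hn' : (3 : ℝ) ≤ n := by exact_mod_cast hn
  have hg : Integrable (fun x : ℝ => x ^ (-2 : ℝ)) (gammaMeasure n 1) :=
    integrable_rpow_gammaMeasure (by linarith) (by linarith)
  have := isProbabilityMeasure_gammaMeasure (a := n) (by linarith) one_pos
  refine ⟨∫ p : ℝ × ℝ, p.1 ^ 2 * p.2 ^ (-2 : ℝ) ∂((leakageLaw n).prod (gammaMeasure n 1)),
    fun t ht => ?_⟩
  rw [mul_comm _ (t ^ 2), ← integral_const_mul]
  refine abs_meanOutage_sub_le (by omega) ht
    (((integrable_sq_leakageLaw n).mul_prod hg).const_mul _) fun w g hw hg => Or.inr (le_of_eq ?_)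
  rw [Real.rpow_neg hg.le, Real.rpow_two]
  ring

/-- The Gamma(2) density `x exp (-x)` cancels `x⁻¹`, leaving an integrand at most `1` on `(0, t]`.
-/
theorem integral_indicator_Iic_inv_gammaMeasure_two {t : ℝ} (ht : 0 ≤ t) :
    ∫ x, (Set.Iic t).indicator (fun x => x⁻¹) x ∂(gammaMeasure (2 : ℕ) 1) ≤ t := by
  rw [integral_gammaMeasure (by norm_num), Nat.cast_ofNat, Real.Gamma_two, inv_one, one_smul]
  calc _ ≤ ∫ x in Set.Ioi (0 : ℝ), (Set.Ioc 0 t).indicator (fun _ => (1 : ℝ)) x := by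
        refine integral_mono_of_nonneg ?_ ?_ ?_
        · refine (ae_restrict_mem measurableSet_Ioi).mono fun x hx => ?_
          have hx' : (0 : ℝ) < x := hx
          have : 0 ≤ (Set.Iic t).indicator (fun x : ℝ => x⁻¹) x :=
            Set.indicator_apply_nonneg fun _ => by positivity
          simp only [Pi.zero_apply, smul_eq_mul]
          positivity
        · refine Integrable.integrableOn ?_
          rw [integrable_indicator_iff measurableSet_Ioc]
          simp
        · refine (ae_restrict_mem measurableSet_Ioi).mono fun x hx => ?_
          have hx' : (0 : ℝ) < x := hx
          have he : Real.exp (-x) ≤ 1 := Real.exp_le_one_iff.mpr (by linarith)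
          by_cases h : x ≤ t
          · norm_num [Set.indicator, h, hx']
            field_simp
            simpa using he
          · simp [Set.indicator, h]
    _ = t := by
        rw [setIntegral_indicator measurableSet_Ioc, Set.inter_eq_right.mpr Set.Ioc_subset_Ioi_self]
        simp [ht]

/-- The integrand reduces to `x⁻¹ exp (-x)`: bounding it by `x⁻¹` up to `1` produces `-log t`, and
by `exp (-x)` beyond `1` a contribution at most `1`. This is the source of the extra factor `B` for
`L = 3`. -/
theorem integral_indicator_Ioi_sq_inv_gammaMeasure_two {t : ℝ} (ht : 0 < t) (ht1 : t ≤ 1) :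
    ∫ x, (Set.Ioi t).indicator (fun x => (x ^ 2)⁻¹) x ∂(gammaMeasure (2 : ℕ) 1) ≤
      1 - Real.log t := by
  rw [integral_gammaMeasure (by norm_num), Nat.cast_ofNat, Real.Gamma_two, inv_one, one_smul]
  have hi1 : IntegrableOn (fun x : ℝ => x⁻¹) (Set.Ioc t 1) := by
    rw [← intervalIntegrable_iff_integrableOn_Ioc_of_le ht1]
    refine intervalIntegral.intervalIntegrable_inv (fun x hx => ?_) continuousOn_id
    rw [Set.uIcc_of_le ht1] at hx
    exact (ht.trans_le hx.1).ne'
  have hi1' : IntegrableOn ((Set.Ioc t 1).indicator fun x : ℝ => x⁻¹) (Set.Ioi 0) :=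
    ((integrable_indicator_iff measurableSet_Ioc).mpr hi1).integrableOn
  have hi2 : IntegrableOn (fun x : ℝ => Real.exp (-x)) (Set.Ioi 0) := integrableOn_exp_neg_Ioi 0
  calc _ ≤ ∫ x in Set.Ioi (0 : ℝ), ((Set.Ioc t 1).indicator (fun x => x⁻¹) x + Real.exp (-x)) := by
        refine integral_mono_of_nonneg ?_ (hi1'.add hi2) ?_
        · refine (ae_restrict_mem measurableSet_Ioi).mono fun x hx => ?_
          have hx' : (0 : ℝ) < x := hx
          have : 0 ≤ (Set.Ioi t).indicator (fun x : ℝ => (x ^ 2)⁻¹) x :=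
            Set.indicator_apply_nonneg fun _ => by positivity
          simp only [Pi.zero_apply, smul_eq_mul]
          positivity
        · refine (ae_restrict_mem measurableSet_Ioi).mono fun x hx => ?_
          have hx' : (0 : ℝ) < x := hx
          have he : Real.exp (-x) ≤ 1 := Real.exp_le_one_iff.mpr (by linarith)
          have he0 := Real.exp_pos (-x)
          have e1 : x ^ ((2 : ℝ) - 1) = x := by norm_num
          simp only [smul_eq_mul, e1]
          have e2 : x * Real.exp (-x) * (x ^ 2)⁻¹ = x⁻¹ * Real.exp (-x) := by field_simp
          by_cases h : t < x
          · rw [Set.indicator_of_mem (show x ∈ Set.Ioi t from h), e2]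
            by_cases h1 : x ≤ 1
            · rw [Set.indicator_of_mem (show x ∈ Set.Ioc t 1 from ⟨h, h1⟩)]
              have := mul_le_mul_of_nonneg_left he (inv_nonneg.mpr hx'.le)
              linarith
            · rw [Set.indicator_of_notMem (fun h2 => h1 h2.2)]
              have := mul_le_mul_of_nonneg_right (inv_le_one_of_one_le₀ (not_le.mp h1).le) he0.le
              linarith
          · rw [Set.indicator_of_notMem (show x ∉ Set.Ioi t from h),
              Set.indicator_of_notMem (fun h2 => h h2.1)]
            linarith
    _ = 1 - Real.log t := by
        rw [integral_add hi1' hi2, setIntegral_indicator measurableSet_Ioc,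
          Set.inter_eq_right.mpr (Set.Ioc_subset_Ioi_self.trans (Set.Ioi_subset_Ioi ht.le)),
          ← intervalIntegral.integral_of_le ht1, integral_inv_of_pos ht one_pos,
          integral_exp_neg_Ioi_zero, one_div, Real.log_inv]
        ring

/-- With no finite inverse second moment, the linear bound is used for `G ≤ t` and the quadratic one
for `G > t`. The constant `2` is the mean of `W`, and `C` its second moment. -/
theorem exists_abs_meanOutage_two_sub_le :
    ∃ C : ℝ, 0 ≤ C ∧ ∀ t : ℝ, 0 < t → t ≤ 1 →
      |meanOutage 2 t - 2 * t| ≤ t ^ 2 * (2 + C * (1 - Real.log t)) := by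
  have := isProbabilityMeasure_gammaMeasure (a := (2 : ℕ)) (by norm_num) one_pos
  have hinv := integrable_inv_gammaMeasure (n := 2) le_rfl
  refine ⟨∫ w, w ^ 2 ∂(leakageLaw 2), integral_nonneg fun w => sq_nonneg w, fun t ht ht1 => ?_⟩
  have i1 : Integrable (fun x => (Set.Iic t).indicator (fun x : ℝ => x⁻¹) x)
      (gammaMeasure (2 : ℕ) 1) := hinv.indicator measurableSet_Iic
  have i2 : Integrable (fun x => (Set.Ioi t).indicator (fun x : ℝ => (x ^ 2)⁻¹) x)
      (gammaMeasure (2 : ℕ) 1) := by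
    refine (hinv.const_mul t⁻¹).mono ((by fun_prop : Measurable fun x : ℝ => (x ^ 2)⁻¹).indicator
      measurableSet_Ioi).aestronglyMeasurable (ae_of_all _ fun x => ?_)
    by_cases h : t < x
    · have hx := ht.trans h
      rw [Set.indicator_of_mem (show x ∈ Set.Ioi t from h), Real.norm_of_nonneg (by positivity),
        Real.norm_of_nonneg (by positivity), sq, mul_inv]
      gcongr
    · rw [Set.indicator_of_notMem (show x ∉ Set.Ioi t from h), norm_zero]
      positivity
  have j1 := ((integrable_leakageLaw 2).mul_prod i1).const_mul t
  have j2 := ((integrable_sq_leakageLaw 2).mul_prod i2).const_mul (t ^ 2)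
  have key := abs_meanOutage_sub_le (n := 2) le_rfl ht.le (j1.add j2) (fun w g hw hg => by
    simp only [Pi.add_apply]
    by_cases h : g ≤ t
    · left
      rw [Set.indicator_of_mem (show g ∈ Set.Iic t from h),
        Set.indicator_of_notMem (show g ∉ Set.Ioi t from not_lt.mpr h), div_eq_mul_inv]
      simp
    · right
      rw [Set.indicator_of_notMem (show g ∉ Set.Iic t from h),
        Set.indicator_of_mem (show g ∈ Set.Ioi t from not_le.mp h)]
      refine le_of_eq ?_
      ring)
  have hn : ((2 : ℕ) : ℝ) / (((2 : ℕ) : ℝ) - 1) = 2 := by norm_num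
  rw [hn] at key
  refine key.trans ?_
  simp only [Pi.add_apply]
  rw [integral_add j1 j2, integral_const_mul, integral_const_mul,
    integral_prod_mul (fun w : ℝ => w), integral_prod_mul (fun w : ℝ => w ^ 2),
    integral_leakageLaw two_pos]
  have b1 := integral_indicator_Iic_inv_gammaMeasure_two ht.le
  have b2 := integral_indicator_Ioi_sq_inv_gammaMeasure_two ht ht1
  have hC : 0 ≤ ∫ w, w ^ 2 ∂(leakageLaw 2) := integral_nonneg fun w => sq_nonneg w
  calc _ ≤ t * (((2 : ℕ) : ℝ) * t) + t ^ 2 * ((∫ w, w ^ 2 ∂(leakageLaw 2)) * (1 - Real.log t)) := by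
        gcongr
    _ = _ := by
        push_cast
        ring

-- Asymptotics in the number of feedback bits.

theorem decay_eq_pow {n : ℕ} (B : ℕ) : decay n B = ((2 : ℝ) ^ (-(n : ℝ)⁻¹)) ^ B := by
  rw [decay, ← Real.rpow_natCast, ← Real.rpow_mul two_pos.le]
  congr 1
  ring

theorem decay_base_lt_one {n : ℕ} (hn : 0 < n) : (2 : ℝ) ^ (-(n : ℝ)⁻¹) < 1 :=
  Real.rpow_lt_one_of_one_lt_of_neg one_lt_two (by
    have : (0 : ℝ) < n := by exact_mod_cast hn
    simpa using this)

theorem tendsto_decay {n : ℕ} (hn : 0 < n) : Tendsto (fun B : ℕ => decay n B) atTop (𝓝 0) := by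
  simp_rw [decay_eq_pow]
  exact tendsto_pow_atTop_nhds_zero_of_lt_one (by positivity) (decay_base_lt_one hn)

theorem tendsto_mul_decay {n : ℕ} (hn : 0 < n) :
    Tendsto (fun B : ℕ => (B : ℝ) * decay n B) atTop (𝓝 0) := by
  simp_rw [decay_eq_pow]
  exact tendsto_self_mul_const_pow_of_lt_one (by positivity) (decay_base_lt_one hn)

theorem isBigO_meanOutage_decay {n : ℕ} (hn : 3 ≤ n) {c : ℝ} (hc : 0 < c) :
    (fun B : ℕ => meanOutage n (c * decay n B) - n / ((n : ℝ) - 1) * (c * decay n B))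
      =O[atTop] fun B : ℕ => decay n B ^ 2 := by
  obtain ⟨C, hC⟩ := exists_abs_meanOutage_sub_le hn
  refine IsBigO.of_bound (C * c ^ 2) (Eventually.of_forall fun B => ?_)
  have hd := decay_pos n B
  rw [Real.norm_eq_abs, Real.norm_of_nonneg (by positivity)]
  refine (hC _ (by positivity)).trans (le_of_eq ?_)
  ring

theorem isBigO_meanOutage_two_decay {c : ℝ} (hc : 0 < c) :
    (fun B : ℕ => meanOutage 2 (c * decay 2 B) - 2 * (c * decay 2 B))
      =O[atTop] fun B : ℕ => (B : ℝ) * decay 2 B ^ 2 := by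
  obtain ⟨C, hC0, hC⟩ := exists_abs_meanOutage_two_sub_le
  refine IsBigO.of_bound (c ^ 2 * (2 + C * (1 + |Real.log c| + Real.log 2))) ?_
  have h1 : ∀ᶠ B : ℕ in atTop, c * decay 2 B < 1 := by
    have := (tendsto_decay two_pos).const_mul c
    rw [mul_zero] at this
    exact this.eventually_lt_const one_pos
  filter_upwards [h1, eventually_ge_atTop 1] with B hB hB1
  have hd := decay_pos 2 B
  have hB1' : (1 : ℝ) ≤ B := by exact_mod_cast hB1
  have hlog : Real.log (c * decay 2 B) = Real.log c - B / 2 * Real.log 2 := by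
    rw [Real.log_mul hc.ne' hd.ne', decay, Real.log_rpow two_pos]
    push_cast
    ring
  have hl2 : 0 < Real.log 2 := Real.log_pos one_lt_two
  have hle : 2 + C * (1 - Real.log (c * decay 2 B)) ≤
      (2 + C * (1 + |Real.log c| + Real.log 2)) * B := by
    -- The logarithm is affine in `B`, and `B ≥ 1` lets the constant terms be absorbed into a
    -- multiple of `B`.
    have e1 : 1 - Real.log (c * decay 2 B) ≤ (1 + |Real.log c| + Real.log 2) * B := by
      rw [hlog]
      have := neg_abs_le (Real.log c)
      nlinarith [abs_nonneg (Real.log c)]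
    have e2 := mul_le_mul_of_nonneg_left e1 hC0
    nlinarith
  rw [Real.norm_eq_abs, Real.norm_of_nonneg (by positivity)]
  calc _ ≤ (c * decay 2 B) ^ 2 * (2 + C * (1 - Real.log (c * decay 2 B))) :=
        hC _ (by positivity) hB.le
    _ ≤ (c * decay 2 B) ^ 2 * ((2 + C * (1 + |Real.log c| + Real.log 2)) * B) := by gcongr
    _ = _ := by ring

/-- The slope `n / (n - 1)` exceeds `1`, and the weaker error `B δ²`, valid for all `n ≥ 2`, is
still `o(δ)`. -/
theorem eventually_lt_meanOutage_decay {n : ℕ} (hn : 2 ≤ n) {c : ℝ} (hc : 0 < c) :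
    ∀ᶠ B : ℕ in atTop, c * decay n B < meanOutage n (c * decay n B) := by
  have hn' : (2 : ℝ) ≤ n := by exact_mod_cast hn
  have hO : (fun B : ℕ => meanOutage n (c * decay n B) - n / ((n : ℝ) - 1) * (c * decay n B))
      =O[atTop] fun B : ℕ => (B : ℝ) * decay n B ^ 2 := by
    rcases hn.eq_or_lt with rfl | h
    · have hn : ((2 : ℕ) : ℝ) / (((2 : ℕ) : ℝ) - 1) = 2 := by norm_num
      simpa only [hn] using isBigO_meanOutage_two_decay hc
    · refine (isBigO_meanOutage_decay h hc).trans (IsBigO.of_bound 1 ?_)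
      filter_upwards [eventually_ge_atTop 1] with B hB
      have hB' : (1 : ℝ) ≤ B := by exact_mod_cast hB
      rw [Real.norm_of_nonneg (by positivity), Real.norm_of_nonneg (by positivity), one_mul]
      exact le_mul_of_one_le_left (by positivity) hB'
  have ho : (fun B : ℕ => (B : ℝ) * decay n B ^ 2) =o[atTop] fun B : ℕ => decay n B := by
    have h1 := ((isLittleO_one_iff ℝ).2 (tendsto_mul_decay (n := n) (by omega))).mul_isBigO
      (isBigO_refl (fun B : ℕ => decay n B) atTop)
    simpa [sq, mul_assoc] using h1
  -- Half of the excess slope `c / (n - 1)` is allotted to the error, leaving the other half as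
  -- strict margin.
  have hpos : 0 < c / (2 * ((n : ℝ) - 1)) := div_pos hc (by linarith)
  filter_upwards [(hO.trans_isLittleO ho).bound hpos] with B hB
  have hd := decay_pos n B
  rw [Real.norm_eq_abs, Real.norm_of_nonneg hd.le] at hB
  have h1 := (abs_le.1 hB).1
  have hn1 : (0 : ℝ) < (n : ℝ) - 1 := by linarith
  have h2 : n / ((n : ℝ) - 1) * (c * decay n B) - c / (2 * ((n : ℝ) - 1)) * decay n B
      = c * decay n B + c / (2 * ((n : ℝ) - 1)) * decay n B := by
    field_simp
    ring
  have h3 : 0 < c / (2 * ((n : ℝ) - 1)) * decay n B := by positivity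
  linarith

end CognitiveBeamforming

-- Assembly of the limit, the expansion and the floor.

theorem mainTheorem3 (L : ℕ) (hL : 3 ≤ L) (lam γp θp θs : ℝ)
    (hlam : 0 < lam) (hlam1 : lam < 1) (hγp : 0 < γp) (hθp : 0 < θp) (hθs : 0 < θs) :
    ∃ Plim : ℕ → ℝ,
      -- for every number of bits `B`, the outage probability tends to `Plim B` as `Pmax → ∞`
      (∀ (B : ℕ) (Ω : Type*) (𝒰 : Type*) [MeasurableSpace Ω] [MeasurableSpace 𝒰]
        (μ : Measure Ω) [IsProbabilityMeasure μ]
        (M : CognitiveBeamforming.SystemModel (𝒰 := 𝒰) μ L lam B)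
        (σ2 : ℝ) (_ : 0 < σ2) (f : ℝ → Ω → EuclideanSpace ℂ (Fin L))
        (_ : ∀ Pmax : ℝ, 0 < Pmax → M.IsBeamformer σ2 γp θp Pmax (f Pmax)),
        Tendsto (fun Pmax : ℝ => M.outage σ2 θs (f Pmax)) atTop (𝓝 (Plim B))) ∧
      -- first-order expansion of the limit
      (4 ≤ L →
        (fun B : ℕ => Plim B - Real.exp (-(θp / γp)) *
            ((((L : ℝ) - 1) * lam * θp * θs) / (((L : ℝ) - 2) * γp)) *
            (2 : ℝ) ^ (-(B : ℝ) / ((L : ℝ) - 1)))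
          =O[atTop] fun B : ℕ => (2 : ℝ) ^ (-(2 * (B : ℝ)) / ((L : ℝ) - 1))) ∧
      (L = 3 →
        (fun B : ℕ => Plim B - Real.exp (-(θp / γp)) *
            ((((L : ℝ) - 1) * lam * θp * θs) / (((L : ℝ) - 2) * γp)) *
            (2 : ℝ) ^ (-(B : ℝ) / ((L : ℝ) - 1)))
          =O[atTop] fun B : ℕ => (B : ℝ) * (2 : ℝ) ^ (-(2 * (B : ℝ)) / ((L : ℝ) - 1))) ∧
      -- outage floor
      (∃ R : ℕ → ℝ,
        (R =O[atTop] fun B : ℕ => (2 : ℝ) ^ (-(2 * (B : ℝ)) / ((L : ℝ) - 1))) ∧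
        ∀ B : ℕ, Real.exp (-(θp / γp)) * (lam * θp * θs / γp) *
            (2 : ℝ) ^ (-(B : ℝ) / ((L : ℝ) - 1)) + R B < Plim B) ∧
      (∀ᶠ B : ℕ in atTop, Real.exp (-(θp / γp)) * (lam * θp * θs / γp) *
            (2 : ℝ) ^ (-(B : ℝ) / ((L : ℝ) - 1)) < Plim B) := by
  obtain ⟨n, rfl⟩ : ∃ n, L = n + 1 := ⟨L - 1, by omega⟩
  have hn : 2 ≤ n := by omega
  have hn0 : 0 < n := by omega
  have hn' : (2 : ℝ) ≤ n := by exact_mod_cast hn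
  have hL1 : ((n + 1 : ℕ) : ℝ) - 1 = n := by push_cast; ring
  have hL2 : ((n + 1 : ℕ) : ℝ) - 2 = (n : ℝ) - 1 := by push_cast; ring
  have hd1 : ∀ B : ℕ, (2 : ℝ) ^ (-(B : ℝ) / (n : ℝ)) = CognitiveBeamforming.decay n B := fun B => rfl
  have hd2 : ∀ B : ℕ, (2 : ℝ) ^ (-(2 * (B : ℝ)) / (n : ℝ)) =
      CognitiveBeamforming.decay n B ^ 2 := by
    intro B
    rw [CognitiveBeamforming.decay, ← Real.rpow_natCast, ← Real.rpow_mul two_pos.le]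
    congr 1
    push_cast
    ring
  simp only [hL1, hL2, hd1, hd2]
  set c : ℝ := θp / γp * (lam * θs) with hcdef
  have hc : 0 < c := by positivity
  set a : ℝ := Real.exp (-(θp / γp))
  have ha : 0 < a := Real.exp_pos _
  have hn1 : (n : ℝ) - 1 ≠ 0 := by linarith
  have hexp : ∀ B : ℕ, a * CognitiveBeamforming.meanOutage n (c * CognitiveBeamforming.decay n B) -
      a * ((n * lam * θp * θs) / (((n : ℝ) - 1) * γp)) * CognitiveBeamforming.decay n B =
      a * (CognitiveBeamforming.meanOutage n (c * CognitiveBeamforming.decay n B) -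
        n / ((n : ℝ) - 1) * (c * CognitiveBeamforming.decay n B)) := by
    intro B
    rw [hcdef]
    field_simp
  have hfloor : ∀ᶠ B : ℕ in atTop, a * (lam * θp * θs / γp) * CognitiveBeamforming.decay n B <
      a * CognitiveBeamforming.meanOutage n (c * CognitiveBeamforming.decay n B) := by
    filter_upwards [CognitiveBeamforming.eventually_lt_meanOutage_decay hn hc] with B hB
    have h : a * (lam * θp * θs / γp) * CognitiveBeamforming.decay n B =
        a * (c * CognitiveBeamforming.decay n B) := by
      rw [hcdef]
      ring
    rw [h]
    exact mul_lt_mul_of_pos_left hB ha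
  refine ⟨fun B => a * CognitiveBeamforming.meanOutage n (c * CognitiveBeamforming.decay n B),
    ?_, ?_, ?_, ?_, hfloor⟩
  · intro B Ω 𝒰 _ _ μ _ M σ2 hσ f hf
    exact M.tendsto_outage hn0 hlam hσ hγp hθp hθs f hf
  · intro h4
    simp only [hexp]
    exact (CognitiveBeamforming.isBigO_meanOutage_decay (by omega) hc).const_mul_left a
  · intro h3
    obtain rfl : n = 2 := by omega
    simp only [hexp]
    have h2 : ((2 : ℕ) : ℝ) / (((2 : ℕ) : ℝ) - 1) = 2 := by norm_num
    rw [h2]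
    exact (CognitiveBeamforming.isBigO_meanOutage_two_decay hc).const_mul_left a
  -- `R` vanishes wherever the floor already holds and otherwise undershoots the gap by `1`. The
  -- floor holds eventually, so `R` is eventually zero and any big-O bound is trivial.
  · refine ⟨fun B => if a * (lam * θp * θs / γp) * CognitiveBeamforming.decay n B <
        a * CognitiveBeamforming.meanOutage n (c * CognitiveBeamforming.decay n B) then 0 else
        a * CognitiveBeamforming.meanOutage n (c * CognitiveBeamforming.decay n B) -
        a * (lam * θp * θs / γp) * CognitiveBeamforming.decay n B - 1, ?_, fun B => ?_⟩
    · refine IsBigO.congr' (isBigO_zero _ _) ?_ EventuallyEq.rfl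
      filter_upwards [hfloor] with B hB
      rw [if_pos hB]
    · dsimp only
      split_ifs with h
      · simpa using h
      · linarith
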